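/- A \emph{graph} here is a finite looped simple graph $G$ (loops allowed, no multiple edges) with $n=|V(G)|$ vertices. Let $A(G)$ be its adjacency matrix over $GF(2)$, whose $(v,v)$ entry is $1$ if and only if $v$ is looped. The \emph{isotropic matroid} $M[IAS(G)]$ is the binary matroid represented by the $n\times 3n$ matrix $IAS(G)=\begin{pmatrix} I & A(G) & A(G)+I\end{pmatrix}$ over $GF(2)$. For a matroid $M$ on a finite set $W$ with rank function $r$, put $\lambda(S)=r(S)+r(W\setminus S)-r(W)$ for $S\subseteq W$. For an integer $k\geq 1$, a set $S\subseteq W$ is a \emph{vertical $k$-separation} of $M$ if $\lambda(S)<k$, $r(S)\geq k$ and $r(W\setminus S)\geq k$. The \emph{vertical connectivity} of $M$ is $$\kappa(M)=\min\bigl(\{k \mid M\text{ has a vertical } k\text{-separation}\}\cup\{r(W)\}\bigr).$$ Let $F$ be a finite $4$-regular multigraph (loops and parallel edges allowed, a loop contributing $2$ to the degree). An \emph{Euler system} $C$ of $F$ consists of one Euler circuit of each connected component of $F$. Its \emph{interlacement graph} is the simple graph on $V(F)$ in which distinct vertices $v,w$ are adjacent if and only if they are met in the cyclic order $v\ldots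 w\ldots v\ldots w$ on one of the circuits of $C$. A graph $G$ is a \emph{circle graph} if the simple graph obtained from $G$ by deleting its loops is the interlacement graph of an Euler system of some $4$-regular multigraph. \textbf{Corollary.} Every circle graph $G$ with $n$ vertices satisfies $$\kappa(M[IAS(G)])\leq\max\{5,\,n-3\}.$$ -/

import Mathlib

namespace Isotropic

/-! ### Matroids: representation by a matrix, and vertical connectivity -/

/-- Augmentation of linearly independent sets of columns. -/
theorem linearIndepOn_augment {K W α : Type*} [Field K] [AddCommGroup W] [Module K W]
    [Finite α] (f : α → W) {I J : Set α} (hI : LinearIndepOn K f I) (hJ : LinearIndepOn K f J)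
    (hIJ : I.ncard < J.ncard) : ∃ e ∈ J, e ∉ I ∧ LinearIndepOn K f (insert e I) := by
  by_contra! h
  have hsub : Submodule.span K (f '' J) ≤ Submodule.span K (f '' I) := by
    rw [Submodule.span_le]
    rintro _ ⟨e, he, rfl⟩
    by_contra hn
    have heI : e ∉ I := fun heI => hn (Submodule.subset_span ⟨e, heI, rfl⟩)
    exact h e he heI ((linearIndepOn_insert heI).2 ⟨hI, hn⟩)
  have key : ∀ {S : Set α}, LinearIndepOn K f S →
      Module.finrank K (Submodule.span K (f '' S)) = S.ncard := by
    intro S hS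
    have : Fintype S := Fintype.ofFinite S
    have h1 := finrank_span_eq_card hS
    rw [← Set.image_eq_range] at h1
    rw [h1, ← Nat.card_eq_fintype_card, Nat.card_coe_set_eq]
  have : FiniteDimensional K (Submodule.span K (f '' I)) :=
    FiniteDimensional.span_of_finite K (Set.toFinite _)
  have := Submodule.finrank_mono hsub
  rw [key hI, key hJ] at this
  omega

/-- The matroid represented by a matrix: its elements are the column indices, and a set of column
indices is independent if the corresponding family of columns is linearly independent. -/
def matrixMatroid {K R α : Type*} [Field K] [Finite α] (A : Matrix R α K) : Matroid α :=
  (IndepMatroid.ofFinite (E := Set.univ) Set.finite_univ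
    (fun I => LinearIndepOn K A.col I)
    (by simp)
    (fun _ _ hJ hIJ => hJ.mono hIJ)
    (fun _ _ hI hJ hIJ => linearIndepOn_augment A.col hI hJ hIJ)
    (fun _ _ => Set.subset_univ _)).matroid

@[simp] theorem matrixMatroid_ground {K R α : Type*} [Field K] [Finite α] (A : Matrix R α K) :
    (matrixMatroid A).E = Set.univ := rfl

@[simp] theorem matrixMatroid_indep_iff {K R α : Type*} [Field K] [Finite α] (A : Matrix R α K)
    {I : Set α} : (matrixMatroid A).Indep I ↔ LinearIndepOn K A.col I := by
  simp [matrixMatroid, IndepMatroid.ofFinite]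

/-- The rank function `r` of a matroid, as a natural number (for matroids of finite rank). -/
noncomputable def rk {α : Type*} (M : Matroid α) (S : Set α) : ℕ := (M.eRk S).toNat

/-- The connectivity function `λ(S) = r(S) + r(W - S) - r(M)`. By submodularity of `r`
the subtraction is never truncated. -/
noncomputable def connFun {α : Type*} (M : Matroid α) (S : Set α) : ℕ :=
  rk M S + rk M (M.E \ S) - rk M M.E

/-- `S` is a vertical `k`-separation of `M`. -/
def IsVerticalSeparation {α : Type*} (M : Matroid α) (k : ℕ) (S : Set α) : Prop :=
  1 ≤ k ∧ S ⊆ M.E ∧ connFun M S < k ∧ k ≤ rk M S ∧ k ≤ rk M (M.E \ S)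

/-- The vertical connectivity `κ(M)`: the minimum of `r(M)` and of all `k` such that `M` has
a vertical `k`-separation. -/
noncomputable def verticalConnectivity {α : Type*} (M : Matroid α) : ℕ :=
  sInf ({k | ∃ S, IsVerticalSeparation M k S} ∪ {rk M M.E})

/-! ### Looped simple graphs and their isotropic matroids -/

/-- A looped simple graph on `V`: non-loop edges (`toSimpleGraph`) and a set of looped vertices. -/
structure LoopedGraph (V : Type*) where
  toSimpleGraph : SimpleGraph V
  looped : Set V

open Classical in
/-- The adjacency matrix over `GF(2)`; diagonal entries record loops. -/
noncomputable def LoopedGraph.adjMatrix {V : Type*} (G : LoopedGraph V) : Matrix V V (ZMod 2) :=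
  fun v w => if (v = w ∧ v ∈ G.looped) ∨ G.toSimpleGraph.Adj v w then 1 else 0

open Classical in
/-- The matrix `IAS(G) = (I  A(G)  A(G)+I)`. -/
noncomputable def LoopedGraph.IAS {V : Type*} (G : LoopedGraph V) :
    Matrix V (V ⊕ V ⊕ V) (ZMod 2) :=
  Matrix.fromCols 1 (Matrix.fromCols G.adjMatrix (G.adjMatrix + 1))

/-- The isotropic matroid `M[IAS(G)]`. -/
noncomputable def LoopedGraph.isotropicMatroid {V : Type*} [Finite V] (G : LoopedGraph V) :
    Matroid (V ⊕ V ⊕ V) :=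
  matrixMatroid G.IAS

/-! ### Circle graphs: interlacement graphs of Euler systems of 4-regular multigraphs -/

/-- The multigraph `F` (loops and parallel edges allowed) is 4-regular; a loop counts twice. -/
def IsFourRegular {V E : Type*} (F : Graph V E) : Prop :=
  ∀ v ∈ F.vertexSet, (F.incidenceSet v).encard + (F.loopSet v).encard = 4

/-- `x` lies in the connected component of `v` in `F`. -/
def Connects {V E : Type*} (F : Graph V E) (v x : V) : Prop :=
  Relation.ReflTransGen F.Adj v x

/-- `C = [(v₀, e₀), …, (vₘ₋₁, eₘ₋₁)]` is an Euler circuit of the connected component of `v`: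
the edge `eᵢ` joins `vᵢ` to `vᵢ₊₁` (indices modulo `m`), and the sequence `e₀, …, eₘ₋₁` lists every
edge of that component exactly once. -/
structure IsEulerCircuit {V E : Type*} (F : Graph V E) (v : V) (C : List (V × E)) : Prop where
  closed : Cycle.Chain (fun a b => F.IsLink a.2 a.1 b.1) (C : Cycle (V × E))
  nodup : (C.map Prod.snd).Nodup
  mem_iff : ∀ e, e ∈ C.map Prod.snd ↔ ∃ x, Connects F v x ∧ F.Inc e x

/-- An Euler system of `F`: a choice of one Euler circuit for each connected component of `F`.
`C v` is the circuit chosen for the component of `v`. -/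
structure IsEulerSystem {V E : Type*} (F : Graph V E) (C : V → List (V × E)) : Prop where
  circuit : ∀ v ∈ F.vertexSet, IsEulerCircuit F v (C v)
  same : ∀ v ∈ F.vertexSet, ∀ w, Connects F v w → C v = C w

/-- `v` and `w` are interlaced on the circuit `C`: going around the circuit one meets them in
the order `v … w … v … w`. (In an Euler circuit of a 4-regular graph each occurs twice; as `C` has
a chosen starting point, both cyclic rotations of the pattern are allowed.) -/
def Interlaced {V E : Type*} (C : List (V × E)) (v w : V) : Prop :=
  [v, w, v, w].Sublist (C.map Prod.fst) ∨ [w, v, w, v].Sublist (C.map Prod.fst)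

/-- The interlacement graph of an Euler system: distinct vertices are adjacent if they are
interlaced on one of the circuits. -/
def interlacementGraph {V E : Type*} (C : V → List (V × E)) : SimpleGraph V where
  Adj v w := v ≠ w ∧ ∃ u, Interlaced (C u) v w
  symm := ⟨fun _ _ h => ⟨h.1.symm, h.2.imp fun _ hu => Or.symm hu⟩⟩
  loopless := ⟨fun _ h => h.1 rfl⟩

/-- `G` is a circle graph: its simple part is the interlacement graph of an Euler system of some
4-regular multigraph on the same vertex set. (Loops of `G` play no role.) -/
def LoopedGraph.IsCircleGraph {V : Type*} (G : LoopedGraph V) : Prop :=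
  ∃ (E : Type) (F : Graph V E) (C : V → List (V × E)),
    F.vertexSet = Set.univ ∧ IsFourRegular F ∧ IsEulerSystem F C ∧
      G.toSimpleGraph = interlacementGraph C

end Isotropic

/-! Short cycles of the 4-regular graph `F` force small separations of `M[IAS(G)]`. Let `A` be a set
of vertices and let `u` range over `d` independent vectors such that both `u` and `A(G)u` vanish
outside `A`. The `3|A|` elements belonging to `A` then have rank at most `2|A| - d`. The remaining
columns are orthogonal to every `u`, so they have rank at most `n - d`. Hence `λ ≤ 2|A| - 2d`, and
if `A` is not too large, `κ ≤ 2|A| - 2d + 1` (`LoopedGraph.verticalConnectivity_add_le`). Such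
vectors come from elements of the cycle space of `F`, that is, edge labellings `h` over `GF(2)` with
even sum at every vertex. Let `u(v)` be the change of `h` when the Euler circuit passes `v`;
evenness makes it the same at both visits. The sum of `u(w)` over the `w` interlaced with `v`
telescopes to the sum of two labels of edges at `v`. So if `h` is constant at `v`, then `u` and
`A(G)u` both vanish there (`IsEulerSystem.exists_linearMap`). The indicator of a cycle of length `g`
(a loop or a digon if `g` is 1 or 2) is constant off its `g` vertices, whence `κ ≤ 2g - 1`. This is
at most 5 for `g ≤ 3`, and at most `n - 3` if `2g + 2 ≤ n`. A triangle-free 4-regular simple graph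
has a cycle with `2g + 2 ≤ n` unless it is `K₄,₄` (`exists_short_cycle_or_completeBipartite`). For
`K₄,₄`, two independent labellings nonconstant only on one side of the bipartition give `κ ≤ 2·4 - 3
= 5`. -/

namespace Isotropic

/-! ### Ranks in the isotropic matroid and separations from vectors of small support. -/

open Module Submodule

/-- The rank of a set of columns is the dimension of their span. -/
theorem rk_matrixMatroid {K R α : Type*} [Field K] [Finite α] (A : Matrix R α K) (S : Set α) :
    rk (matrixMatroid A) S = finrank K (span K (A.col '' S)) := by
  obtain ⟨I, hI⟩ := (matrixMatroid A).exists_isBasis S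
  have hind : LinearIndepOn K A.col I := (matrixMatroid_indep_iff A).1 hI.indep
  have hspan : span K (A.col '' S) = span K (A.col '' I) := by
    refine le_antisymm (span_le.2 ?_) (span_mono (Set.image_mono hI.subset))
    rintro _ ⟨e, he, rfl⟩
    by_contra hn
    have heI : e ∉ I := fun heI => hn (subset_span ⟨e, heI, rfl⟩)
    exact heI (hI.mem_of_insert_indep he ((matrixMatroid_indep_iff A).2
      ((linearIndepOn_insert heI).2 ⟨hind, hn⟩)))
  have : Fintype I := Fintype.ofFinite I
  have h1 := finrank_span_eq_card hind
  rw [← Set.image_eq_range] at h1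
  rw [hspan, h1, rk, ← hI.encard_eq_eRk, ← Nat.card_eq_fintype_card, Nat.card_coe_set_eq,
    Set.ncard]

section

variable {V : Type*}

/-- The vertex to which an element of the isotropic matroid belongs. -/
def vertexOf : V ⊕ V ⊕ V → V := Sum.elim id (Sum.elim id id)

theorem LoopedGraph.adjMatrix_symm (G : LoopedGraph V) (v w : V) :
    G.adjMatrix v w = G.adjMatrix w v := by
  classical
  refine if_congr ?_ rfl rfl
  rw [G.toSimpleGraph.adj_comm v w]
  refine or_congr_left ⟨?_, ?_⟩ <;> rintro ⟨rfl, h⟩ <;> exact ⟨rfl, h⟩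

theorem LoopedGraph.col_IAS_inl (G : LoopedGraph V) [DecidableEq V] (a : V) :
    G.IAS.col (Sum.inl a) = Pi.single a 1 := by
  ext v
  simp [LoopedGraph.IAS, Matrix.one_apply, Pi.single_apply]

theorem LoopedGraph.col_IAS_inr_inl (G : LoopedGraph V) (a : V) :
    G.IAS.col (Sum.inr (Sum.inl a)) = G.adjMatrix.col a := by
  ext v
  simp [LoopedGraph.IAS]

theorem LoopedGraph.col_IAS_inr_inr (G : LoopedGraph V) [DecidableEq V] (a : V) :
    G.IAS.col (Sum.inr (Sum.inr a)) = G.adjMatrix.col a + Pi.single a 1 := by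
  ext v
  simp [LoopedGraph.IAS, Matrix.one_apply, Pi.single_apply]

variable [Fintype V]

theorem LoopedGraph.rk_univ (G : LoopedGraph V) :
    rk G.isotropicMatroid Set.univ = Fintype.card V := by
  classical
  rw [LoopedGraph.isotropicMatroid, rk_matrixMatroid]
  have : span (ZMod 2) (G.IAS.col '' Set.univ) = ⊤ := by
    rw [eq_top_iff, ← (Pi.basisFun (ZMod 2) V).span_eq]
    refine span_mono ?_
    rintro _ ⟨a, rfl⟩
    exact ⟨Sum.inl a, trivial, by rw [G.col_IAS_inl, Pi.basisFun_apply]⟩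
  rw [this, finrank_top, finrank_fintype_fun_eq_card]

/-- Columns that are orthogonal to `d` independent vectors have corank at least `d`. -/
theorem rk_add_le_of_orthogonal {K α : Type*} [Field K] [Finite α] (M : Matrix V α K) {S : Set α}
    {d : ℕ} {u : Fin d → V → K} (hu : LinearIndependent K u)
    (h : ∀ s ∈ S, ∀ i, u i ⬝ᵥ M.col s = 0) :
    rk (matrixMatroid M) S + d ≤ Fintype.card V := by
  rw [rk_matrixMatroid]
  have hle : span K (M.col '' S) ≤ LinearMap.ker (Matrix.of u).mulVecLin := by
    rw [span_le]
    rintro _ ⟨s, hs, rfl⟩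
    ext i
    exact h s hs i
  have hr : finrank K (LinearMap.range (Matrix.of u).mulVecLin) = d := by
    have := LinearIndependent.rank_matrix (M := Matrix.of u) hu
    rw [Fintype.card_fin] at this
    exact this
  have h1 := LinearMap.finrank_range_add_finrank_ker (Matrix.of u).mulVecLin
  rw [finrank_fintype_fun_eq_card] at h1
  have h2 := Submodule.finrank_mono hle
  omega

theorem mem_span_single_of_support {K : Type*} [Field K] [DecidableEq K] [DecidableEq V]
    {A : Finset V} {x : V → K} (hx : ∀ b ∉ A, x b = 0) :
    x ∈ span K (A.image (fun a => (Pi.single a 1 : V → K)) : Set (V → K)) := by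
  have : x = ∑ a ∈ A, x a • (Pi.single a 1 : V → K) := by
    ext b
    simp only [Finset.sum_apply, Pi.smul_apply, Pi.single_apply, smul_eq_mul, mul_ite, mul_one,
      mul_zero, Finset.sum_ite_eq]
    split_ifs with hb
    · rfl
    · exact hx b hb
  rw [this]
  exact sum_mem fun a ha => smul_mem _ _ (subset_span (by
    rw [Finset.mem_coe]; exact Finset.mem_image_of_mem _ ha))

variable {A : Finset V} {d : ℕ} {u : Fin d → V → ZMod 2}

/-- The columns in question lie in `P + A(G)P`, where `P` is the coordinate space of `A`. Since
`A(G)` maps `U = span u` into `P`, only a complement of `U` in `P`, of dimension `|A| - d`,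
contributes to the second summand. -/
theorem LoopedGraph.rk_add_le_two_mul_card (G : LoopedGraph V)
    (hu : LinearIndependent (ZMod 2) u) (h₁ : ∀ i, ∀ b ∉ A, u i b = 0)
    (h₂ : ∀ i, ∀ b ∉ A, G.adjMatrix.mulVec (u i) b = 0) :
    d ≤ A.card ∧ rk G.isotropicMatroid {s | vertexOf s ∈ A} + d ≤ 2 * A.card := by
  classical
  set P : Submodule (ZMod 2) (V → ZMod 2) :=
    span (ZMod 2) (A.image (fun a => (Pi.single a 1 : V → ZMod 2)) : Set (V → ZMod 2)) with hP
  have hPcard : finrank (ZMod 2) P ≤ A.card :=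
    (finrank_span_finset_le_card _).trans Finset.card_image_le
  set U : Submodule (ZMod 2) (V → ZMod 2) := span (ZMod 2) (Set.range u) with hU
  have hUcard : finrank (ZMod 2) U = d := by
    rw [hU, finrank_span_eq_card hu, Fintype.card_fin]
  have hUP : U ≤ P := span_le.2 (by
    rintro _ ⟨i, rfl⟩
    exact mem_span_single_of_support (h₁ i))
  have hMU : U.map G.adjMatrix.mulVecLin ≤ P := by
    rw [Submodule.map_le_iff_le_comap, hU, span_le]
    rintro _ ⟨i, rfl⟩
    exact mem_span_single_of_support (h₂ i)
  obtain ⟨W, hW⟩ := Submodule.exists_isCompl U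
  have hsup : U ⊔ W ⊓ P = P := by
    rw [← sup_inf_assoc_of_le W hUP, hW.sup_eq_top, top_inf_eq]
  have hinf : U ⊓ (W ⊓ P) = ⊥ := by
    rw [← inf_assoc, hW.inf_eq_bot, bot_inf_eq]
  have hdim := Submodule.finrank_sup_add_finrank_inf_eq U (W ⊓ P)
  rw [hsup, hinf, finrank_bot, hUcard] at hdim
  have hle : span (ZMod 2) (G.IAS.col '' {s | vertexOf s ∈ A}) ≤
      P ⊔ (W ⊓ P).map G.adjMatrix.mulVecLin := by
    have hmap : P.map G.adjMatrix.mulVecLin ≤ P ⊔ (W ⊓ P).map G.adjMatrix.mulVecLin := by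
      conv_lhs => rw [← hsup, Submodule.map_sup]
      exact sup_le_sup_right hMU _
    have hs : ∀ a ∈ A, (Pi.single a 1 : V → ZMod 2) ∈ P := fun a ha => subset_span (by
      rw [Finset.mem_coe]; exact Finset.mem_image_of_mem _ ha)
    have hc : ∀ a ∈ A, G.adjMatrix.col a ∈ P ⊔ (W ⊓ P).map G.adjMatrix.mulVecLin := fun a ha =>
      hmap ⟨_, hs a ha, by rw [Matrix.mulVecLin_apply, Matrix.mulVec_single_one]⟩
    rw [span_le]
    rintro _ ⟨a | a | a, ha, rfl⟩
    · rw [G.col_IAS_inl]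
      exact mem_sup_left (hs a ha)
    · rw [G.col_IAS_inr_inl]
      exact hc a ha
    · rw [G.col_IAS_inr_inr]
      exact add_mem (hc a ha) (mem_sup_left (hs a ha))
  have h1 := Submodule.finrank_mono hle
  have h2 := Submodule.finrank_add_le_finrank_add_finrank P ((W ⊓ P).map G.adjMatrix.mulVecLin)
  have h3 := Submodule.finrank_map_le G.adjMatrix.mulVecLin (W ⊓ P)
  rw [LoopedGraph.isotropicMatroid, rk_matrixMatroid]
  omega

/-- If `d ≥ 1` independent vectors `u` are such that `u` and `A(G) u` both vanish outside
a small set `A` of vertices, then the elements belonging to `A` form a vertical separation. -/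
theorem LoopedGraph.verticalConnectivity_add_le (G : LoopedGraph V)
    (hu : LinearIndependent (ZMod 2) u) (h₁ : ∀ i, ∀ b ∉ A, u i b = 0)
    (h₂ : ∀ i, ∀ b ∉ A, G.adjMatrix.mulVec (u i) b = 0) (hd : 0 < d)
    (hA : 2 * A.card + 1 ≤ Fintype.card V + d) :
    verticalConnectivity G.isotropicMatroid + 2 * d ≤ 2 * A.card + 1 := by
  classical
  set S : Set (V ⊕ V ⊕ V) := {s | vertexOf s ∈ A} with hS
  have hE : G.isotropicMatroid.E = Set.univ := rfl
  obtain ⟨hdA, hr⟩ := G.rk_add_le_two_mul_card hu h₁ h₂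
  rw [← hS] at hr
  have hr' : rk G.isotropicMatroid (Set.univ \ S) + d ≤ Fintype.card V := by
    refine rk_add_le_of_orthogonal G.IAS hu ?_
    have hcol : ∀ i, ∀ b ∉ A, u i ⬝ᵥ G.adjMatrix.col b = 0 := by
      intro i b hb
      rw [← h₂ i b hb, dotProduct_comm]
      exact Finset.sum_congr rfl fun w _ => by rw [Matrix.col_apply, G.adjMatrix_symm]
    rintro (b | b | b) hb i <;> replace hb : b ∉ A := hb.2
    · rw [G.col_IAS_inl, dotProduct_single, h₁ i b hb, zero_mul]
    · rw [G.col_IAS_inr_inl, hcol i b hb]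
    · rw [G.col_IAS_inr_inr, dotProduct_add, hcol i b hb, dotProduct_single, h₁ i b hb, zero_mul,
        add_zero]
  have hsub : Fintype.card V ≤ rk G.isotropicMatroid S + rk G.isotropicMatroid (Set.univ \ S) := by
    rw [← G.rk_univ, LoopedGraph.isotropicMatroid]
    simp only [rk_matrixMatroid]
    have : G.IAS.col '' Set.univ = G.IAS.col '' S ∪ G.IAS.col '' (Set.univ \ S) := by
      rw [← Set.image_union, Set.union_sdiff_self, Set.union_univ]
    rw [this, span_union]
    exact Submodule.finrank_add_le_finrank_add_finrank _ _
  -- After cancelling in `λ(S) + 1`, the two rank conditions say that the complement of `S` and `S`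
  -- itself have rank below `n`; these follow from `hd` and `hA` respectively.
  have hsep : IsVerticalSeparation G.isotropicMatroid (connFun G.isotropicMatroid S + 1) S := by
    refine ⟨by omega, by rw [hE]; exact Set.subset_univ _, Nat.lt_succ_self _, ?_, ?_⟩ <;>
    · rw [connFun, hE, G.rk_univ]
      omega
  have hle : verticalConnectivity G.isotropicMatroid ≤ connFun G.isotropicMatroid S + 1 :=
    Nat.sInf_le (Or.inl ⟨S, hsep⟩)
  rw [connFun, hE, G.rk_univ] at hle
  omega

theorem LoopedGraph.verticalConnectivity_le_card (G : LoopedGraph V) :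
    verticalConnectivity G.isotropicMatroid ≤ Fintype.card V := by
  rw [← G.rk_univ]
  exact Nat.sInf_le (Or.inr rfl)

end

end Isotropic

/-! ### Even labellings along a closed trail. -/

namespace Isotropic

open Finset

variable {V E : Type*} {F : Graph V E}

/-- The labelling `h` sums to `0` modulo 2 around every vertex (loops cancel out). -/
def IsEvenLabelling (F : Graph V E) (h : E → ZMod 2) : Prop :=
  ∀ v, ∑ᶠ e ∈ {e | F.IsNonloopAt e v}, h e = 0

/-- All edges at `v` have the same label. -/
def IsConstantAt (F : Graph V E) (h : E → ZMod 2) (v : V) : Prop :=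
  ∀ e f, F.Inc e v → F.Inc f v → h e = h f

/-- The periodic sequences `x` of vertices and `e` of edges run through a closed trail of length `m`
containing every edge at the vertices it meets. -/
structure IsPeriodicTrail (F : Graph V E) (m : ℕ) (x : ℕ → V) (e : ℕ → E) : Prop where
  link : ∀ i, F.IsLink (e i) (x i) (x (i + 1))
  vertex_period : ∀ i, x (i + m) = x i
  edge_period : ∀ i, e (i + m) = e i
  inj : ∀ i < m, ∀ j < m, e i = e j → i = j
  full : ∀ i f, F.Inc f (x i) → ∃ j < m, e j = f

theorem sum_range_shift {M : Type*} [AddCommGroup M] {m : ℕ} {f : ℕ → M}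
    (hf : ∀ i, f (i + m) = f i) : ∑ i ∈ range m, f (i + 1) = ∑ i ∈ range m, f i := by
  have h := (sum_range_succ' f m).symm.trans (sum_range_succ f m)
  have h0 : f m = f 0 := by simpa using hf 0
  rw [h0] at h
  exact add_right_cancel h

theorem zmod_two_eq_of_add_eq_zero {a b : ZMod 2} (h : a + b = 0) : a = b :=
  CharTwo.add_eq_zero.1 h

namespace IsPeriodicTrail

variable {m : ℕ} {x : ℕ → V} {e : ℕ → E}

theorem inc_iff (T : IsPeriodicTrail F m x e) (i : ℕ) (v : V) :
    F.Inc (e i) v ↔ x i = v ∨ x (i + 1) = v := by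
  constructor
  · intro h
    exact (h.eq_or_eq_of_isLink (T.link i)).imp Eq.symm Eq.symm
  · rintro (rfl | rfl)
    exacts [(T.link i).inc_left, (T.link i).inc_right]

theorem isLoopAt_iff (T : IsPeriodicTrail F m x e) (i : ℕ) (v : V) :
    F.IsLoopAt (e i) v ↔ x i = v ∧ x (i + 1) = v := by
  constructor
  · intro h
    exact ⟨(h.eq_of_inc (T.link i).inc_left).symm, (h.eq_of_inc (T.link i).inc_right).symm⟩
  · rintro ⟨h₁, h₂⟩
    have := T.link i
    rwa [h₁, h₂] at this

theorem injOn (T : IsPeriodicTrail F m x e) (s : Set ℕ) (hs : ∀ i ∈ s, i < m) : s.InjOn e :=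
  fun i hi j hj h => T.inj i (hs i hi) j (hs j hj) h

theorem pos (T : IsPeriodicTrail F m x e) : 0 < m := by
  obtain ⟨j, hj, -⟩ := T.full 0 (e 0) (T.link 0).inc_left
  omega

theorem image_setOf_lt (T : IsPeriodicTrail F m x e) {v : V} (hv : ∃ i, x i = v) {Q : E → Prop}
    (hQ : ∀ f, Q f → F.Inc f v) : {f | Q f} = e '' {i | i < m ∧ Q (e i)} := by
  obtain ⟨i, rfl⟩ := hv
  ext f
  constructor
  · intro hf
    obtain ⟨j, hj, rfl⟩ := T.full i f (hQ f hf)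
    exact ⟨j, ⟨hj, hf⟩, rfl⟩
  · rintro ⟨j, hj, rfl⟩
    exact hj.2

/-- In a 4-regular graph, a trail using all edges at `v` visits `v` exactly twice. -/
theorem exists_visits (T : IsPeriodicTrail F m x e) (hF : IsFourRegular F) {v : V}
    (hv : ∃ i, x i = v) :
    ∃ p q, p < q ∧ q < m ∧ ∀ i < m, x i = v ↔ i = p ∨ i = q := by
  classical
  -- `s` indexes the edges leaving `v` and `t` those entering it. Loops at `v` lie in both, so `|s|
  -- + |t|` is the degree 4, and a cyclic shift gives `|s| = |t|`.
  set s := {i ∈ range m | x i = v} with hs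
  set t := {i ∈ range m | x (i + 1) = v} with ht
  have hst : s.card = t.card := by
    have := sum_range_shift (M := ℤ) (m := m) (f := fun i => if x i = v then 1 else 0)
      (fun i => by rw [T.vertex_period])
    rw [sum_boole, sum_boole] at this
    exact_mod_cast this.symm
  have hinc : (F.incidenceSet v).encard = (s ∪ t).card := by
    have h1 : F.incidenceSet v = e '' ((s ∪ t : Finset ℕ) : Set ℕ) := by
      refine (T.image_setOf_lt hv (Q := fun f => F.Inc f v) fun _ h => h).trans ?_
      congr 1
      ext i
      simp only [T.inc_iff, hs, ht, Set.mem_ofPred_eq, coe_union, coe_filter, mem_range,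
        Set.mem_union]
      tauto
    rw [h1, (T.injOn _ _).encard_image, Set.encard_coe_eq_coe_finsetCard]
    intro i hi
    simp only [hs, ht, coe_union, coe_filter, mem_range, Set.mem_union, Set.mem_ofPred_eq] at hi
    tauto
  have hloop : (F.loopSet v).encard = (s ∩ t).card := by
    have h1 : F.loopSet v = e '' ((s ∩ t : Finset ℕ) : Set ℕ) := by
      refine (T.image_setOf_lt hv (Q := fun f => F.IsLoopAt f v) fun _ h => h.inc).trans ?_
      congr 1
      ext i
      simp only [T.isLoopAt_iff, hs, ht, Set.mem_ofPred_eq, coe_inter, coe_filter, mem_range,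
        Set.mem_inter_iff]
      tauto
    rw [h1, (T.injOn _ _).encard_image, Set.encard_coe_eq_coe_finsetCard]
    intro i hi
    simp only [hs, ht, coe_inter, coe_filter, mem_range, Set.mem_inter_iff,
      Set.mem_ofPred_eq] at hi
    tauto
  have hvF : v ∈ F.vertexSet := by
    obtain ⟨i, rfl⟩ := hv
    exact (T.link i).left_mem
  have h4 := hF v hvF
  rw [hinc, hloop] at h4
  have h4' : (s ∪ t).card + (s ∩ t).card = 4 := by exact_mod_cast h4
  rw [card_union_add_card_inter] at h4'
  obtain ⟨a, b, hab, hs2⟩ := card_eq_two.1 (show s.card = 2 by omega)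
  have hmem : ∀ i, (i < m ∧ x i = v) ↔ i = a ∨ i = b := by
    intro i
    have : i ∈ s ↔ i ∈ ({a, b} : Finset ℕ) := by rw [hs2]
    simpa [hs] using this
  have ha := (hmem a).2 (Or.inl rfl)
  have hb := (hmem b).2 (Or.inr rfl)
  rcases lt_or_gt_of_ne hab with h | h
  · exact ⟨a, b, h, hb.1, fun i hi => by rw [← hmem i]; tauto⟩
  · exact ⟨b, a, h, ha.1, fun i hi => by rw [or_comm, ← hmem i]; tauto⟩

/-- The change of the label when the trail passes its `i`-th vertex. -/
def jump (h : E → ZMod 2) (m : ℕ) (e : ℕ → E) (i : ℕ) : ZMod 2 := h (e (i + (m - 1))) + h (e i)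

theorem jump_succ (T : IsPeriodicTrail F m x e) (h : E → ZMod 2) (i : ℕ) :
    jump h m e (i + 1) = h (e i) + h (e (i + 1)) := by
  have := T.pos
  rw [jump, show i + 1 + (m - 1) = i + m by omega, T.edge_period]

/-- Telescoping in characteristic 2: every label strictly between the two ends occurs twice. -/
theorem sum_jump (T : IsPeriodicTrail F m x e) (h : E → ZMod 2) {p r : ℕ} (hpr : p ≤ r) :
    ∑ i ∈ Ioc p r, jump h m e i = h (e p) + h (e r) := by
  induction r, hpr using Nat.le_induction with
  | base => simp [CharTwo.add_self_eq_zero]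
  | succ r hr ih =>
    rw [← Finset.insert_Ioc_right_eq_Ioc_add_one (by omega), sum_insert (by simp), ih,
      T.jump_succ]
    linear_combination CharTwo.add_self_eq_zero (h (e r))

/-- An even labelling changes by the same amount at both visits of a vertex. -/
theorem jump_eq_jump (T : IsPeriodicTrail F m x e) {h : E → ZMod 2} (hh : IsEvenLabelling F h)
    {v : V} {p q : ℕ} (hpq : p < q) (hq : q < m) (hv : ∀ i < m, x i = v ↔ i = p ∨ i = q) :
    jump h m e p = jump h m e q := by
  classical
  have hvx : ∃ i, x i = v := ⟨p, (hv p (by omega)).2 (Or.inl rfl)⟩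
  have hnl : ∀ i, F.IsNonloopAt (e i) v ↔ ¬ (x i = v ↔ x (i + 1) = v) := by
    intro i
    rw [Graph.isNonloopAt_iff_inc_not_isLoopAt, T.inc_iff, T.isLoopAt_iff]
    tauto
  have h1 := hh v
  rw [T.image_setOf_lt hvx (Q := fun f => F.IsNonloopAt f v) fun _ h => h.inc,
    finsum_mem_image (T.injOn _ fun i hi => hi.1)] at h1
  have h2 : {i | i < m ∧ F.IsNonloopAt (e i) v} =
      ((range m).filter fun i => ¬ (x i = v ↔ x (i + 1) = v) : Finset ℕ) := by
    ext i
    simp [hnl]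
  rw [h2, finsum_mem_coe_finset, sum_filter] at h1
  -- Summing the jumps over the visits of `v` adds the labels of all arriving and departing edges.
  -- Loops count twice and cancel, which leaves the sum in `IsEvenLabelling`.
  have h3 : ∑ i ∈ range m, (if x i = v then jump h m e i else 0) = 0 := by
    have hshift := sum_range_shift (m := m)
      (f := fun i => if x i = v then h (e (i + (m - 1))) else 0)
      (fun i => by rw [T.vertex_period, add_right_comm, T.edge_period])
    refine Eq.trans ?_ h1
    have hstep : ∀ i, e (i + 1 + (m - 1)) = e i := fun i => by
      have := T.pos
      rw [show i + 1 + (m - 1) = i + m by omega, T.edge_period]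
    simp only [hstep] at hshift
    have hsplit : ∀ i, (if x i = v then jump h m e i else 0) =
        (if x i = v then h (e (i + (m - 1))) else 0) + (if x i = v then h (e i) else 0) := by
      intro i
      split_ifs <;> simp [jump]
    simp only [hsplit, sum_add_distrib]
    rw [← hshift, ← sum_add_distrib]
    refine sum_congr rfl fun i _ => ?_
    by_cases ha : x i = v <;> by_cases hb : x (i + 1) = v <;>
      simp [ha, hb, CharTwo.add_self_eq_zero]
  rw [← sum_filter] at h3
  have h4 : (range m).filter (fun i => x i = v) = {p, q} := by
    ext i
    simp only [mem_filter, mem_range, mem_insert, mem_singleton]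
    constructor
    · rintro ⟨hi, h⟩
      exact (hv i hi).1 h
    · intro h
      have hi : i < m := by omega
      exact ⟨hi, (hv i hi).2 h⟩
  rw [h4, sum_pair hpq.ne] at h3
  exact zmod_two_eq_of_add_eq_zero h3

theorem eq_of_jump_eq_zero (T : IsPeriodicTrail F m x e) {h : E → ZMod 2}
    (hj : ∀ i < m, jump h m e i = 0) : ∀ i < m, h (e i) = h (e 0) := by
  intro i
  induction i with
  | zero => intro _; rfl
  | succ i ih =>
    intro hi
    have := hj (i + 1) hi
    rw [T.jump_succ] at this
    rw [← ih (by omega)]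
    exact (zmod_two_eq_of_add_eq_zero this).symm

theorem jump_eq_zero_of_isConstantAt (T : IsPeriodicTrail F m x e) {h : E → ZMod 2} {i : ℕ}
    (hc : IsConstantAt F h (x i)) : jump h m e i = 0 := by
  have h1 : F.Inc (e (i + (m - 1))) (x i) := by
    rw [T.inc_iff]
    right
    have := T.pos
    rw [show i + (m - 1) + 1 = i + m by omega, T.vertex_period]
  rw [jump, hc _ _ h1 (T.link i).inc_left, CharTwo.add_self_eq_zero]

end IsPeriodicTrail

theorem quadruple_sublist_map_range {x : ℕ → V} {m : ℕ} {v w : V} :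
    [v, w, v, w].Sublist ((List.range m).map x) ↔
      ∃ i j k l, i < j ∧ j < k ∧ k < l ∧ l < m ∧ x i = v ∧ x j = w ∧ x k = v ∧ x l = w := by
  rw [List.sublist_map_iff]
  constructor
  · rintro ⟨l', hl, heq⟩
    have hlt := List.pairwise_lt_range.sublist hl
    have hmem := hl.subset
    obtain _ | ⟨i, _ | ⟨j, _ | ⟨k, _ | ⟨l, _ | ⟨_, _⟩⟩⟩⟩⟩ := l' <;> simp at heq
    simp at hlt
    simp at hmem
    exact ⟨i, j, k, l, by tauto, by tauto, by tauto, by tauto, by tauto, by tauto, by tauto,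
      by tauto⟩
  · rintro ⟨i, j, k, l, hij, hjk, hkl, hl, rfl, rfl, h3, h4⟩
    refine ⟨[i, j, k, l], ?_, by simp [h3, h4]⟩
    refine List.sublist_of_subperm_of_pairwise (r := (· < ·)) (List.subperm_of_subset ?_ ?_) ?_
      List.pairwise_lt_range
    · simp; omega
    · intro a ha
      simp at ha ⊢
      omega
    · simp; omega

/-- Interlacement means that exactly one of the two visits of `w` falls strictly between those of
`v`; zero or two such visits vanish modulo 2. The open interval is written `Ioc p (q - 1)` to match
`sum_jump`. -/
theorem IsPeriodicTrail.card_visits_between {m : ℕ} {x : ℕ → V} {e : ℕ → E} [DecidableEq V]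
    (T : IsPeriodicTrail F m x e)
    (hF : IsFourRegular F) {v w : V} (hvw : v ≠ w) {p q : ℕ} (hpq : p < q) (hq : q < m)
    (hv : ∀ i < m, x i = v ↔ i = p ∨ i = q) [Decidable (
      [v, w, v, w].Sublist ((List.range m).map x) ∨ [w, v, w, v].Sublist ((List.range m).map x))] :
    (({i ∈ Ioc p (q - 1) | x i = w}.card : ℕ) : ZMod 2) =
      if [v, w, v, w].Sublist ((List.range m).map x) ∨
        [w, v, w, v].Sublist ((List.range m).map x) then 1 else 0 := by
  by_cases hw : ∃ i, x i = w
  · obtain ⟨p', q', hpq', hq', hw⟩ := T.exists_visits hF hw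
    have hne : p ≠ p' ∧ p ≠ q' ∧ q ≠ p' ∧ q ≠ q' := by
      have hp := (hv p (by omega)).2 (Or.inl rfl)
      have hq1 := (hv q (by omega)).2 (Or.inr rfl)
      have hp' := (hw p' (by omega)).2 (Or.inl rfl)
      have hq1' := (hw q' (by omega)).2 (Or.inr rfl)
      refine ⟨?_, ?_, ?_, ?_⟩ <;> rintro rfl <;> simp_all
    have hset : {i ∈ Ioc p (q - 1) | x i = w} = {i ∈ ({p', q'} : Finset ℕ) | p < i ∧ i < q} := by
      ext i
      simp only [mem_filter, mem_Ioc, mem_insert, mem_singleton]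
      constructor
      · rintro ⟨h1, h2⟩
        exact ⟨(hw i (by omega)).1 h2, by omega, by omega⟩
      · rintro ⟨h1, h2⟩
        exact ⟨by omega, (hw i (by omega)).2 h1⟩
    have hiff : ([v, w, v, w].Sublist ((List.range m).map x) ∨
        [w, v, w, v].Sublist ((List.range m).map x)) ↔
        (p < p' ∧ p' < q ∧ q < q') ∨ (p' < p ∧ p < q' ∧ q' < q) := by
      rw [quadruple_sublist_map_range, quadruple_sublist_map_range]
      refine or_congr ⟨?_, ?_⟩ ⟨?_, ?_⟩
      · rintro ⟨i, j, k, l, hij, hjk, hkl, hl, h1, h2, h3, h4⟩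
        rw [hv _ (by omega)] at h1 h3
        rw [hw _ (by omega)] at h2 h4
        omega
      · rintro ⟨h1, h2, h3⟩
        exact ⟨p, p', q, q', h1, h2, h3, hq', (hv _ (by omega)).2 (Or.inl rfl),
          (hw _ (by omega)).2 (Or.inl rfl), (hv _ (by omega)).2 (Or.inr rfl),
          (hw _ (by omega)).2 (Or.inr rfl)⟩
      · rintro ⟨i, j, k, l, hij, hjk, hkl, hl, h1, h2, h3, h4⟩
        rw [hw _ (by omega)] at h1 h3
        rw [hv _ (by omega)] at h2 h4
        omega
      · rintro ⟨h1, h2, h3⟩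
        exact ⟨p', p, q', q, h1, h2, h3, hq, (hw _ (by omega)).2 (Or.inl rfl),
          (hv _ (by omega)).2 (Or.inl rfl), (hw _ (by omega)).2 (Or.inr rfl),
          (hv _ (by omega)).2 (Or.inr rfl)⟩
    simp only [hiff]
    rw [hset, filter_insert, filter_singleton]
    by_cases c1 : p < p' ∧ p' < q <;> by_cases c2 : p < q' ∧ q' < q
    · rw [if_pos c1, if_pos c2, if_neg (by omega), card_insert_of_notMem (by simp; omega)]
      simp; rfl
    · rw [if_pos c1, if_neg c2, if_pos (by omega)]
      simp
    · rw [if_neg c1, if_pos c2, if_pos (by omega)]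
      simp
    · rw [if_neg c1, if_neg c2, if_neg (by omega)]
      simp
  · push Not at hw
    rw [filter_false_of_mem fun i _ => hw i, if_neg]
    · simp
    · rw [quadruple_sublist_map_range, quadruple_sublist_map_range]
      rintro (⟨i, j, k, l, -, -, -, -, -, h, -⟩ | ⟨i, j, k, l, -, -, -, -, h, -⟩)
      exacts [hw _ h, hw _ h]

end Isotropic

/-! ### From Euler systems to vectors over `GF(2)`. -/

namespace Isotropic

open Finset

variable {V E : Type*} {F : Graph V E}

/-- The `i`-th term of the list `L`, read cyclically. -/
def cyclicGet (d : V × E) (L : List (V × E)) (i : ℕ) : V × E := L.getD (i % L.length) d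

theorem cyclicGet_of_lt (d : V × E) {L : List (V × E)} {i : ℕ} (hi : i < L.length) :
    cyclicGet d L i = L[i] := by
  rw [cyclicGet, Nat.mod_eq_of_lt hi, List.getD_eq_getElem _ _ hi]

theorem cyclicGet_mod (d : V × E) (L : List (V × E)) (i : ℕ) :
    cyclicGet d L (i % L.length) = cyclicGet d L i := by
  rw [cyclicGet, Nat.mod_mod, cyclicGet]

theorem map_cyclicGet_range (d : V × E) (L : List (V × E)) :
    (List.range L.length).map (cyclicGet d L) = L := by
  refine List.ext_getElem (by simp) fun i h₁ h₂ => ?_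
  simp [cyclicGet_of_lt d h₂]

theorem IsEulerCircuit.link {v : V} {L : List (V × E)} (hL : IsEulerCircuit F v L) (hne : L ≠ [])
    (d : V × E) (i : ℕ) :
    F.IsLink (cyclicGet d L i).2 (cyclicGet d L i).1 (cyclicGet d L (i + 1)).1 := by
  obtain ⟨a, l, rfl⟩ := List.exists_cons_of_ne_nil hne
  have hc := hL.closed
  rw [Cycle.chain_coe_cons, ← List.cons_append, List.isChain_iff_getElem] at hc
  rw [← cyclicGet_mod d _ i, ← cyclicGet_mod d _ (i + 1), Nat.add_mod]
  set m := (a :: l).length with hm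
  have hm1 : m = l.length + 1 := by simp [hm]
  have hi : i % m < m := Nat.mod_lt _ (by omega)
  have h := hc (i % m) (by simp; omega)
  rw [List.getElem_append_left (by omega)] at h
  rw [cyclicGet_of_lt d hi]
  -- The chain condition concerns the list with its head repeated at the end, so the last edge must
  -- be compared with index 0.
  by_cases hlast : i % m + 1 = m
  · have h0 : (i % m + 1 % m) % m = 0 := by rw [Nat.add_mod_mod, hlast, Nat.mod_self]
    rw [h0, cyclicGet_of_lt d (by omega)]
    rw [List.getElem_append_right (by omega)] at h
    simpa using h
  · have h0 : (i % m + 1 % m) % m = i % m + 1 := by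
      rw [Nat.add_mod_mod, Nat.mod_eq_of_lt (by omega)]
    rw [h0, cyclicGet_of_lt d (by omega)]
    rwa [List.getElem_append_left (by omega)] at h

theorem Connects.of_isLink {v x y : V} {e : E} (h : Connects F v x) (he : F.IsLink e x y) :
    Connects F v y :=
  Relation.ReflTransGen.tail h he.adj

theorem IsEulerCircuit.connects {v : V} {L : List (V × E)} (hL : IsEulerCircuit F v L)
    (hne : L ≠ []) (d : V × E) (i : ℕ) : Connects F v (cyclicGet d L i).1 := by
  have hmem : (cyclicGet d L i).2 ∈ L.map Prod.snd := by
    have hpos := List.length_pos_iff.2 hne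
    rw [← cyclicGet_mod, cyclicGet_of_lt d (Nat.mod_lt _ hpos)]
    exact List.mem_map_of_mem (List.getElem_mem _)
  obtain ⟨y, hy, hinc⟩ := (hL.mem_iff _).1 hmem
  have hlink := hL.link hne d i
  rcases hinc.eq_or_eq_of_isLink hlink with rfl | rfl
  · exact hy
  · exact hy.of_isLink hlink.symm

theorem IsEulerCircuit.isPeriodicTrail {v : V} {L : List (V × E)} (hL : IsEulerCircuit F v L)
    (hne : L ≠ []) (d : V × E) :
    IsPeriodicTrail F L.length (fun i => (cyclicGet d L i).1) (fun i => (cyclicGet d L i).2) where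
  link := hL.link hne d
  vertex_period i := by rw [← cyclicGet_mod, Nat.add_mod_right, cyclicGet_mod]
  edge_period i := by rw [← cyclicGet_mod, Nat.add_mod_right, cyclicGet_mod]
  inj i hi j hj h := by
    have h' : (cyclicGet d L i).2 = (cyclicGet d L j).2 := h
    rw [cyclicGet_of_lt d hi, cyclicGet_of_lt d hj] at h'
    exact (hL.nodup.getElem_inj_iff (hi := by simpa using hi) (hj := by simpa using hj)).1
      (by simpa using h')
  full i f hf := by
    have hmem := (hL.mem_iff f).2 ⟨_, hL.connects hne d i, hf⟩
    obtain ⟨j, hj, rfl⟩ := List.mem_iff_getElem.1 hmem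
    rw [List.length_map] at hj
    exact ⟨j, hj, by simp [cyclicGet_of_lt d hj]⟩

/-- An Euler system of a 4-regular graph turns even edge labellings into vectors `u` over `GF(2)`
such that `u` and its product with the adjacency matrix of the interlacement graph vanish at
the vertices where the labelling is constant. Only labellings that are constant at all vertices
are sent to `0`. -/
theorem IsEulerSystem.exists_linearMap [Fintype V] {C : V → List (V × E)}
    (hV : F.vertexSet = Set.univ) (hF : IsFourRegular F) (hC : IsEulerSystem F C)
    [DecidableRel (interlacementGraph C).Adj] :
    ∃ Φ : (E → ZMod 2) →ₗ[ZMod 2] (V → ZMod 2), ∀ h, IsEvenLabelling F h →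
      (∀ v, IsConstantAt F h v → Φ h v = 0 ∧
        ∑ w, (if (interlacementGraph C).Adj v w then Φ h w else 0) = 0) ∧
      (Φ h = 0 → ∀ v, IsConstantAt F h v) := by
  classical
  have hmem : ∀ v, v ∈ F.vertexSet := fun v => hV ▸ Set.mem_univ v
  have hinc : ∀ v, ∃ f, F.Inc f v := by
    intro v
    by_contra! hno
    have h1 : F.incidenceSet v = ∅ := Set.eq_empty_of_forall_notMem hno
    have h2 : F.loopSet v = ∅ := Set.eq_empty_of_forall_notMem fun e he => hno e he.inc
    have := hF v (hmem v)
    simp [h1, h2] at this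
  rcases isEmpty_or_nonempty V with hemp | ⟨⟨v₀⟩⟩
  · exact ⟨0, fun h _ => ⟨fun v => hemp.elim v, fun _ v => hemp.elim v⟩⟩
  obtain ⟨f₀, -⟩ := hinc v₀
  -- The default value for `cyclicGet`; it is never returned, as every circuit `C v` is nonempty.
  set d : V × E := (v₀, f₀)
  have hcirc : ∀ v, IsEulerCircuit F v (C v) := fun v => hC.circuit v (hmem v)
  have hne : ∀ v, C v ≠ [] := by
    intro v h0
    obtain ⟨f, hf⟩ := hinc v
    have := ((hcirc v).mem_iff f).2 ⟨v, Relation.ReflTransGen.refl, hf⟩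
    simp [h0] at this
  have hT := fun v => (hcirc v).isPeriodicTrail (hne v) d
  have hsame : ∀ u i, C u = C (cyclicGet d (C u) i).1 := fun u i =>
    hC.same u (hmem u) _ ((hcirc u).connects (hne u) d i)
  have hvisit : ∀ v, ∃ i, (cyclicGet d (C v) i).1 = v := by
    intro v
    obtain ⟨f, hf⟩ := hinc v
    obtain ⟨j, hj, hjf⟩ :=
      List.mem_iff_getElem.1 (((hcirc v).mem_iff f).2 ⟨v, Relation.ReflTransGen.refl, hf⟩)
    rw [List.length_map] at hj
    have hj' : (cyclicGet d (C v) j).2 = f := by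
      rw [cyclicGet_of_lt d hj, ← hjf, List.getElem_map]
    rw [← hj'] at hf
    rcases ((hT v).inc_iff j v).1 hf with h | h
    exacts [⟨_, h⟩, ⟨_, h⟩]
  choose p q hpq hq hpos using fun v => (hT v).exists_visits hF (hvisit v)
  have hxp : ∀ v, (cyclicGet d (C v) (p v)).1 = v := fun v =>
    (hpos v _ ((hpq v).trans (hq v))).2 (Or.inl rfl)
  have hxq : ∀ v, (cyclicGet d (C v) (q v)).1 = v := fun v =>
    (hpos v _ (hq v)).2 (Or.inr rfl)
  -- The first visit `p v` is an arbitrary choice: for even `h` the second gives the same value,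
  -- which is the content of `hΦ`.
  let Φ : (E → ZMod 2) →ₗ[ZMod 2] (V → ZMod 2) :=
    { toFun := fun h v =>
        IsPeriodicTrail.jump h (C v).length (fun i => (cyclicGet d (C v) i).2) (p v)
      map_add' := fun h k => by
        ext v
        simp only [IsPeriodicTrail.jump, Pi.add_apply]
        ring
      map_smul' := fun c h => by
        ext v
        simp only [IsPeriodicTrail.jump, Pi.smul_apply, smul_eq_mul, RingHom.id_apply]
        ring }
  refine ⟨Φ, fun h hh => ?_⟩
  have hΦ : ∀ u, ∀ i < (C u).length, Φ h (cyclicGet d (C u) i).1 =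
      IsPeriodicTrail.jump h (C u).length (fun i => (cyclicGet d (C u) i).2) i := by
    intro u i hi
    set w := (cyclicGet d (C u) i).1 with hw
    have hCw : C u = C w := hsame u i
    rw [hCw] at hi hw ⊢
    have hjump := (hT w).jump_eq_jump hh (hpq w) (hq w) (hpos w)
    rcases (hpos w i hi).1 hw.symm with h | h
    · rw [h]; rfl
    · rw [h, ← hjump]; rfl
  constructor
  · intro v hv
    have h0 : Φ h v = 0 := (hT v).jump_eq_zero_of_isConstantAt (i := p v) (by rwa [hxp v])
    refine ⟨h0, ?_⟩
    have hadj : ∀ w, (interlacementGraph C).Adj v w ↔ v ≠ w ∧ Interlaced (C v) v w := by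
      intro w
      refine and_congr_right fun _ => ⟨?_, fun h => ⟨v, h⟩⟩
      rintro ⟨u, hu⟩
      have hvu : v ∈ (C u).map Prod.fst := by
        rcases hu with hu | hu <;> exact hu.subset (by simp)
      obtain ⟨j, hj, hjv⟩ := List.mem_iff_getElem.1 hvu
      rw [List.length_map] at hj
      have hj' : (cyclicGet d (C u) j).1 = v := by
        rw [cyclicGet_of_lt d hj, ← hjv, List.getElem_map]
      have := hsame u j
      rw [hj'] at this
      rwa [← this]
    have hmap : (C v).map Prod.fst =
        (List.range (C v).length).map fun i => (cyclicGet d (C v) i).1 := by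
      conv_lhs => rw [← map_cyclicGet_range d (C v), List.map_map]
      rfl
    -- Modulo 2, adjacency to `v` counts the visits of `w` between the two visits of `v`. The term
    -- `w = v` is harmless because `Φ h v = 0`.
    have hcount : ∀ w, (if (interlacementGraph C).Adj v w then Φ h w else 0) =
        ({i ∈ Ioc (p v) (q v - 1) | (cyclicGet d (C v) i).1 = w}.card : ZMod 2) * Φ h w := by
      intro w
      by_cases hvw : v = w
      · subst hvw
        rw [h0, mul_zero, ite_self]
      · rw [(hT v).card_visits_between hF hvw (hpq v) (hq v) (hpos v), ← hmap]
        by_cases hi : Interlaced (C v) v w <;> unfold Interlaced at hi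
        · rw [if_pos ((hadj w).2 ⟨hvw, hi⟩), if_pos hi, one_mul]
        · rw [if_neg fun h => hi ((hadj w).1 h).2, if_neg hi, zero_mul]
    have hpq' := hpq v
    have hq' := hq v
    -- The sum telescopes to the labels of the edge leaving `v` at `p v` and of the edge entering it
    -- at `q v`; these agree by constancy at `v`.
    have hsum : ∑ i ∈ Ioc (p v) (q v - 1), Φ h (cyclicGet d (C v) i).1 = 0 := by
      rw [sum_congr rfl fun i hi => hΦ v i (by rw [mem_Ioc] at hi; omega),
        (hT v).sum_jump h (by omega)]
      have h1 : F.Inc (cyclicGet d (C v) (p v)).2 v := ((hT v).inc_iff _ _).2 (Or.inl (hxp v))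
      have h2 : F.Inc (cyclicGet d (C v) (q v - 1)).2 v := by
        refine ((hT v).inc_iff _ _).2 (Or.inr ?_)
        rw [Nat.sub_add_cancel (by omega)]
        exact hxq v
      rw [hv _ _ h1 h2, CharTwo.add_self_eq_zero]
    rw [sum_congr rfl fun w _ => hcount w, ← hsum,
      ← sum_fiberwise (Ioc (p v) (q v - 1)) (fun i => (cyclicGet d (C v) i).1)]
    refine sum_congr rfl fun w _ => ?_
    rw [sum_congr rfl (g := fun _ => Φ h w) fun i hi => by rw [(mem_filter.1 hi).2], sum_const,
      nsmul_eq_mul]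
  · intro h0 v e f he hf
    -- Without jumps the label is constant along the whole circuit, which uses every edge at `v`.
    have hconst := (hT v).eq_of_jump_eq_zero (h := h) fun i hi => by
      rw [← hΦ v i hi, h0]; rfl
    have hall : ∀ g, F.Inc g v → h g = h (cyclicGet d (C v) 0).2 := by
      intro g hg
      obtain ⟨i, hi⟩ := hvisit v
      obtain ⟨j, hj, rfl⟩ := (hT v).full i g (by rwa [hi])
      exact hconst j hj
    rw [hall e he, hall f hf]

end Isotropic

/-! ### Short cycles in 4-regular simple graphs. -/

namespace Isotropic

open Finset

variable {V : Type*} {Γ : SimpleGraph V}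

/-- The sequence `c` runs periodically through a cycle of length `g` in `Γ`. -/
structure IsPeriodicCycle (Γ : SimpleGraph V) (g : ℕ) (c : ℕ → V) : Prop where
  three_le : 3 ≤ g
  period : ∀ i, c (i + g) = c i
  inj : ∀ i a b, a < g → b < g → c (i + a) = c (i + b) → a = b
  adj : ∀ i, Γ.Adj (c i) (c (i + 1))

theorem exists_isPeriodicCycle_of_path {g : ℕ} {p : ℕ → V} (hg : 3 ≤ g)
    (hinj : ∀ a b, a < b → b < g → p a ≠ p b) (hadj : ∀ i, i + 1 < g → Γ.Adj (p i) (p (i + 1)))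
    (hlast : Γ.Adj (p (g - 1)) (p 0)) : ∃ c, IsPeriodicCycle Γ g c := by
  have hlt : ∀ i, i % g < g := fun i => Nat.mod_lt _ (by omega)
  refine ⟨fun i => p (i % g), hg, fun i => by simp, fun i a b ha hb h => ?_, fun i => ?_⟩
  · have hmod : (i + a) % g = (i + b) % g := by
      rcases lt_trichotomy ((i + a) % g) ((i + b) % g) with h1 | h1 | h1
      · exact absurd h (hinj _ _ h1 (hlt _))
      · exact h1
      · exact absurd h.symm (hinj _ _ h1 (hlt _))
    exact Nat.ModEq.eq_of_lt_of_lt (Nat.ModEq.add_left_cancel' i hmod) ha hb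
  · have hi := hlt i
    rw [← Nat.mod_add_mod]
    by_cases h : i % g + 1 = g
    · rw [h, Nat.mod_self, show i % g = g - 1 by omega]
      exact hlast
    · rw [Nat.mod_eq_of_lt (by omega : i % g + 1 < g)]
      exact hadj _ (by omega)

theorem exists_isPeriodicCycle_three {a b c : V} (hab : Γ.Adj a b) (hbc : Γ.Adj b c)
    (hca : Γ.Adj c a) : ∃ c', IsPeriodicCycle Γ 3 c' := by
  refine exists_isPeriodicCycle_of_path
    (p := fun i => if i = 0 then a else if i = 1 then b else c) le_rfl ?_ ?_ (by simpa using hca)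
  · intro i j hij hj
    obtain ⟨rfl, rfl⟩ | ⟨rfl, rfl⟩ | ⟨rfl, rfl⟩ :
      (i = 0 ∧ j = 1) ∨ (i = 0 ∧ j = 2) ∨ (i = 1 ∧ j = 2) := by omega
    · simpa using hab.ne
    · simpa using hca.ne.symm
    · simpa using hbc.ne
  · intro i hi
    obtain rfl | rfl : i = 0 ∨ i = 1 := by omega
    · simpa using hab
    · simpa using hbc

namespace IsPeriodicCycle

variable {g : ℕ} {c : ℕ → V}

theorem period_mul (hc : IsPeriodicCycle Γ g c) (i k : ℕ) : c (i + g * k) = c i := by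
  induction k with
  | zero => rfl
  | succ k ih => rw [Nat.mul_succ, ← add_assoc, hc.period, ih]

theorem mod (hc : IsPeriodicCycle Γ g c) (i : ℕ) : c (i % g) = c i := by
  conv_rhs => rw [← Nat.mod_add_div i g, hc.period_mul]

theorem congr (hc : IsPeriodicCycle Γ g c) {i j : ℕ} (h : c i = c j) (k : ℕ) :
    c (i + k) = c (j + k) := by
  have hlt : ∀ i, i % g < g := fun i => Nat.mod_lt _ (by have := hc.three_le; omega)
  have hmod : i % g = j % g := hc.inj 0 _ _ (hlt i) (hlt j) (by simpa [hc.mod] using h)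
  rw [← hc.mod, ← hc.mod (j + k), ← Nat.mod_add_mod, hmod, Nat.mod_add_mod]

/-- The edges of the cycle, as a graph. -/
def toSimpleGraph (hc : IsPeriodicCycle Γ g c) : SimpleGraph V where
  Adj x y := ∃ i, (x = c i ∧ y = c (i + 1)) ∨ (y = c i ∧ x = c (i + 1))
  symm := ⟨fun _ _ ⟨i, h⟩ => ⟨i, h.symm⟩⟩
  loopless := ⟨fun x ⟨i, h⟩ => (hc.adj i).ne (by rcases h with ⟨h1, h2⟩ | ⟨h1, h2⟩ <;>
    rw [← h1, ← h2])⟩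

theorem toSimpleGraph_le (hc : IsPeriodicCycle Γ g c) : hc.toSimpleGraph ≤ Γ := by
  rintro x y ⟨i, ⟨rfl, rfl⟩ | ⟨rfl, rfl⟩⟩
  exacts [hc.adj i, (hc.adj i).symm]

theorem toSimpleGraph_adj_iff (hc : IsPeriodicCycle Γ g c) (i : ℕ) (y : V) :
    hc.toSimpleGraph.Adj (c i) y ↔ y = c (i + 1) ∨ y = c (i + (g - 1)) := by
  have h3 := hc.three_le
  constructor
  · rintro ⟨j, ⟨h, rfl⟩ | ⟨rfl, h⟩⟩
    · exact Or.inl (hc.congr h 1).symm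
    · right
      rw [hc.congr h (g - 1), show j + 1 + (g - 1) = j + g by omega, hc.period]
  · rintro (rfl | rfl)
    · exact ⟨i, Or.inl ⟨rfl, rfl⟩⟩
    · refine ⟨i + (g - 1), Or.inr ⟨rfl, ?_⟩⟩
      rw [show i + (g - 1) + 1 = i + g by omega, hc.period]

theorem next_ne_prev (hc : IsPeriodicCycle Γ g c) (i : ℕ) : c (i + 1) ≠ c (i + (g - 1)) := by
  have h3 := hc.three_le
  intro h
  have := hc.inj i _ _ (by omega) (by omega) h
  omega

theorem even_degree (hc : IsPeriodicCycle Γ g c) [Fintype V]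
    [DecidableRel hc.toSimpleGraph.Adj] (v : V) : Even (hc.toSimpleGraph.degree v) := by
  classical
  by_cases hv : ∃ i, v = c i
  · obtain ⟨i, rfl⟩ := hv
    have : hc.toSimpleGraph.neighborFinset (c i) = {c (i + 1), c (i + (g - 1))} := by
      ext y
      rw [SimpleGraph.mem_neighborFinset, hc.toSimpleGraph_adj_iff, mem_insert, mem_singleton]
    rw [← SimpleGraph.card_neighborFinset_eq_degree, this, card_pair (hc.next_ne_prev i)]
    exact even_two
  · push Not at hv
    have : hc.toSimpleGraph.neighborFinset v = ∅ := by
      rw [eq_empty_iff_forall_notMem]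
      intro y hy
      rw [SimpleGraph.mem_neighborFinset] at hy
      obtain ⟨i, ⟨h, -⟩ | ⟨-, h⟩⟩ := hy
      exacts [hv _ h, hv _ h]
    rw [← SimpleGraph.card_neighborFinset_eq_degree, this]
    simp

/-- A chord of a cycle yields a shorter cycle. -/
theorem exists_of_chord (hc : IsPeriodicCycle Γ g c) {i k : ℕ} (hk : 2 ≤ k) (hkg : k < g)
    (h : Γ.Adj (c i) (c (i + k))) : ∃ c', IsPeriodicCycle Γ (k + 1) c' := by
  refine exists_isPeriodicCycle_of_path (p := fun j => c (i + j)) (by omega) ?_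
    (fun j _ => hc.adj _) h.symm
  intro a b hab hb h
  have := hc.inj i a b (by omega) (by omega) h
  omega

/-- A vertex off a cycle with two neighbours on it yields another cycle. -/
theorem exists_of_common_neighbor (hc : IsPeriodicCycle Γ g c) {i k : ℕ} {x : V} (hk : 1 ≤ k)
    (hkg : k < g) (hx : ∀ j, x ≠ c j) (h₁ : Γ.Adj x (c i)) (h₂ : Γ.Adj x (c (i + k))) :
    ∃ c', IsPeriodicCycle Γ (k + 2) c' := by
  refine exists_isPeriodicCycle_of_path (p := fun j => if j = 0 then x else c (i + (j - 1)))
    (by omega) ?_ ?_ ?_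
  · intro a b hab hb h
    rw [if_neg (by omega : b ≠ 0)] at h
    by_cases ha : a = 0
    · rw [if_pos ha] at h
      exact hx _ h
    · rw [if_neg ha] at h
      have := hc.inj i _ _ (by omega) (by omega) h
      omega
  · intro j hj
    rw [if_neg (by omega : j + 1 ≠ 0)]
    by_cases h0 : j = 0
    · subst h0
      simpa using h₁
    · rw [if_neg h0, show i + (j + 1 - 1) = i + (j - 1) + 1 by omega]
      exact hc.adj _
  · simpa using h₂.symm

/-- A shortest cycle of length at least 5 in a 4-regular graph has at least twice as many
neighbours as vertices. -/
theorem three_mul_le_card [Fintype V] [DecidableRel Γ.Adj] (hc : IsPeriodicCycle Γ g c)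
    (hΓ : Γ.IsRegularOfDegree 4)
    (hmin : ∀ k < g, ∀ c', ¬ IsPeriodicCycle Γ k c') (hg : 5 ≤ g) :
    3 * g ≤ Fintype.card V := by
  classical
  set A := (range g).image c with hA
  have hAmem : ∀ j, c j ∈ A := fun j =>
    mem_image.2 ⟨j % g, mem_range.2 (Nat.mod_lt _ (by omega)), hc.mod j⟩
  have hAcard : A.card = g := by
    rw [hA, card_image_of_injOn, card_range]
    intro a ha b hb h
    rw [mem_coe, mem_range] at ha hb
    exact hc.inj 0 a b ha hb (by simpa using h)
  set O : ℕ → Finset V := fun i => Γ.neighborFinset (c i) \ A with hO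
  -- A chord would give a shorter cycle, so only two of the four neighbours of `c i` lie on the
  -- cycle.
  have hOcard : ∀ i, 2 ≤ (O i).card := by
    intro i
    have hsub : Γ.neighborFinset (c i) ∩ A ⊆ {c (i + 1), c (i + (g - 1))} := by
      intro y hy
      rw [mem_inter, SimpleGraph.mem_neighborFinset] at hy
      obtain ⟨hy, hyA⟩ := hy
      obtain ⟨j, -, rfl⟩ := mem_image.1 hyA
      have hex : ∃ k < g, c j = c (i + k) := by
        refine ⟨(j + (g - 1) * i) % g, Nat.mod_lt _ (by omega), ?_⟩
        rw [← hc.mod (i + _), Nat.add_mod_mod, hc.mod,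
          show i + (j + (g - 1) * i) = j + g * i by
            obtain ⟨t, rfl⟩ := Nat.exists_eq_add_of_le' (show 1 ≤ g by omega)
            simp; ring, hc.period_mul]
      obtain ⟨k, hk, hjk⟩ := hex
      rw [hjk] at hy ⊢
      rw [mem_insert, mem_singleton]
      by_cases h0 : k = 0
      · subst h0; exact absurd rfl hy.ne
      by_cases h1 : k = 1
      · left; rw [h1]
      by_cases h2 : k = g - 1
      · right; rw [h2]
      obtain ⟨c', hc'⟩ := hc.exists_of_chord (by omega) hk hy
      exact absurd hc' (hmin _ (by omega) c')
    have h1 := card_le_card hsub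
    have h2 : ({c (i + 1), c (i + (g - 1))} : Finset V).card ≤ 2 := card_le_two
    have h3 := card_sdiff_add_card_inter (Γ.neighborFinset (c i)) A
    rw [SimpleGraph.card_neighborFinset_eq_degree, hΓ] at h3
    simp only [hO]
    omega
  have hdisj : ((range g : Finset ℕ) : Set ℕ).PairwiseDisjoint O := by
    have key : ∀ i j, i < j → j < g → ∀ y, y ∈ O i → y ∈ O j → False := by
      intro i j hij hj y hyi hyj
      simp only [hO, mem_sdiff, SimpleGraph.mem_neighborFinset] at hyi hyj
      have hyA : ∀ l, y ≠ c l := fun l h => hyi.2 (h ▸ hAmem l)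
      have e1 := hc.exists_of_common_neighbor (i := i) (k := j - i) (by omega) (by omega) hyA
        hyi.1.symm (by rw [show i + (j - i) = j by omega]; exact hyj.1.symm)
      have e2 := hc.exists_of_common_neighbor (i := j) (k := g - (j - i)) (by omega) (by omega)
        hyA hyj.1.symm (by
          rw [show j + (g - (j - i)) = i + g by omega, hc.period]; exact hyi.1.symm)
      obtain ⟨c₁, h₁⟩ := e1
      obtain ⟨c₂, h₂⟩ := e2
      -- With `k = j - i`, the two cycles through `y` have lengths `k + 2` and `g - k + 2`.
      -- Minimality forces `g - 2 ≤ k ≤ 2`, contrary to `5 ≤ g`.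
      have h₁' : ¬ (j - i + 2 < g) := fun h => hmin _ h _ h₁
      have h₂' : ¬ (g - (j - i) + 2 < g) := fun h => hmin _ h _ h₂
      omega
    intro i hi j hj hne
    rw [mem_coe, mem_range] at hi hj
    refine disjoint_left.2 fun y hyi hyj => ?_
    rcases lt_or_gt_of_ne hne with h | h
    · exact key i j h hj y hyi hyj
    · exact key j i h hi y hyj hyi
  have hU : 2 * g ≤ ((range g).biUnion O).card := by
    rw [card_biUnion hdisj]
    calc 2 * g = ∑ _i ∈ range g, 2 := by rw [sum_const, card_range, smul_eq_mul, mul_comm]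
      _ ≤ _ := sum_le_sum fun i _ => hOcard i
  have hAU : Disjoint A ((range g).biUnion O) := by
    refine disjoint_left.2 fun y hy hy' => ?_
    obtain ⟨i, -, hi⟩ := mem_biUnion.1 hy'
    exact (mem_sdiff.1 hi).2 hy
  have := card_le_univ (A ∪ (range g).biUnion O)
  rw [card_union_of_disjoint hAU] at this
  omega

end IsPeriodicCycle

variable [Fintype V] [DecidableRel Γ.Adj]

theorem exists_isPeriodicCycle [Nonempty V] (hΓ : ∀ v, 2 ≤ Γ.degree v) :
    ∃ g c, IsPeriodicCycle Γ g c := by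
  classical
  have hnext : ∀ a b, ∃ w, Γ.Adj b w ∧ w ≠ a := by
    intro a b
    have h1 : 1 < (Γ.neighborFinset b).card := by
      rw [SimpleGraph.card_neighborFinset_eq_degree]; exact hΓ b
    obtain ⟨w, hw, hwa⟩ := exists_mem_ne h1 a
    exact ⟨w, (Γ.mem_neighborFinset b w).1 hw, hwa⟩
  choose next hadj hne using hnext
  obtain ⟨v₀⟩ := ‹Nonempty V›
  -- A walk that never turns back; the state holds its last two vertices.
  let s : ℕ → V × V := fun n => Nat.rec (v₀, v₀) (fun _ z => (z.2, next z.1 z.2)) n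
  let f : ℕ → V := fun n => (s n).2
  have hf1 : ∀ n, Γ.Adj (f n) (f (n + 1)) := fun n => hadj _ _
  have hf2 : ∀ n, f (n + 2) ≠ f n := fun n => hne _ _
  have hex : ∃ k, 0 < k ∧ ∃ i, f (i + k) = f i := by
    obtain ⟨i, j, hij, h⟩ := Finite.exists_ne_map_eq_of_infinite f
    rcases lt_or_gt_of_ne hij with hlt | hlt
    · exact ⟨j - i, by omega, i, by rw [show i + (j - i) = j by omega, h]⟩
    · exact ⟨i - j, by omega, j, by rw [show j + (i - j) = i by omega, h]⟩
  -- The return time `k` is least over all starting points, so no vertex repeats within it.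
  -- Adjacency excludes `k = 1`, and not turning back excludes `k = 2`.
  obtain ⟨hk, i, hi⟩ := Nat.find_spec hex
  have hmin := fun k hk => Nat.find_min hex (m := k) hk
  set k := Nat.find hex
  have h1 : k ≠ 1 := fun h => (hf1 i).ne (by rw [h] at hi; exact hi.symm)
  have h2 : k ≠ 2 := fun h => hf2 i (by rw [h] at hi; exact hi)
  refine ⟨k, exists_isPeriodicCycle_of_path (p := fun j => f (i + j)) (by omega) ?_
    (fun j _ => hf1 _) ?_⟩
  · intro a b hab hb h
    refine hmin (b - a) (by omega) ⟨by omega, i + a, ?_⟩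
    rw [show i + a + (b - a) = i + b by omega]
    exact h.symm
  · have := hf1 (i + (k - 1))
    rw [show i + (k - 1) + 1 = i + k by omega, hi] at this
    exact this

/-- A 4-regular graph has a short cycle, or it is the complete bipartite graph `K₄,₄`. -/
theorem exists_short_cycle_or_completeBipartite (hΓ : Γ.IsRegularOfDegree 4) [Nonempty V] :
    (∃ g c, IsPeriodicCycle Γ g c ∧ (g ≤ 3 ∨ 2 * g + 2 ≤ Fintype.card V)) ∨
      (Fintype.card V = 8 ∧ ∃ A : Finset V, A.card = 4 ∧
        ∀ x y, Γ.Adj x y ↔ (x ∈ A ↔ y ∉ A)) := by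
  classical
  by_cases htri : ∃ c, IsPeriodicCycle Γ 3 c
  · obtain ⟨c, hc⟩ := htri
    exact Or.inl ⟨3, c, hc, Or.inl le_rfl⟩
  have hfree : ∀ a b c, Γ.Adj a b → Γ.Adj b c → Γ.Adj c a → False := fun a b c h₁ h₂ h₃ =>
    htri (exists_isPeriodicCycle_three h₁ h₂ h₃)
  have hN : ∀ v, (Γ.neighborFinset v).card = 4 := fun v => by
    rw [SimpleGraph.card_neighborFinset_eq_degree, hΓ]
  obtain ⟨v⟩ := ‹Nonempty V›
  obtain ⟨w, hw⟩ := card_pos.1 (by rw [hN v]; omega : 0 < (Γ.neighborFinset v).card)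
  rw [SimpleGraph.mem_neighborFinset] at hw
  set A := Γ.neighborFinset v with hA
  set B := Γ.neighborFinset w with hB
  have hmA : ∀ y, y ∈ A ↔ Γ.Adj v y := fun y => Γ.mem_neighborFinset v y
  have hmB : ∀ y, y ∈ B ↔ Γ.Adj w y := fun y => Γ.mem_neighborFinset w y
  have hdisj : Disjoint A B := by
    refine disjoint_left.2 fun y h1 h2 => ?_
    exact hfree v w y hw ((hmB y).1 h2) ((hmA y).1 h1).symm
  have hAA : ∀ a ∈ A, ∀ y ∈ A, ¬ Γ.Adj a y := fun a ha y hy h =>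
    hfree v a y ((hmA a).1 ha) h ((hmA y).1 hy).symm
  have hBB : ∀ a ∈ B, ∀ y ∈ B, ¬ Γ.Adj a y := fun a ha y hy h =>
    hfree w a y ((hmB a).1 ha) h ((hmB y).1 hy).symm
  have hcardAB : (A ∪ B).card = 8 := by rw [card_union_of_disjoint hdisj, hN, hN]
  have h8 : 8 ≤ Fintype.card V := hcardAB ▸ card_le_univ _
  by_cases h10 : 10 ≤ Fintype.card V
  · left
    have hex : ∃ g, ∃ c, IsPeriodicCycle Γ g c :=
      haveI : Nonempty V := ⟨v⟩
      exists_isPeriodicCycle fun v => by rw [hΓ]; omega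
    obtain ⟨c, hc⟩ := Nat.find_spec hex
    refine ⟨_, c, hc, Or.inr ?_⟩
    -- Girth `g ≥ 5` gives `2g + 2 ≤ 3g ≤ n`; girth at most 4 gives `2g + 2 ≤ 10 ≤ n`.
    by_cases h5 : 5 ≤ Nat.find hex
    · have := hc.three_mul_le_card hΓ (fun k hk c' hc' => Nat.find_min hex hk ⟨c', hc'⟩) h5
      omega
    · omega
  right
  have hcompl : (A ∪ B)ᶜ.card + 8 = Fintype.card V := by
    rw [← hcardAB, add_comm, card_add_card_compl]
  by_cases h9 : Fintype.card V = 9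
  · exfalso
    obtain ⟨x, hx⟩ := card_eq_one.1 (show (A ∪ B)ᶜ.card = 1 by omega)
    have hall : ∀ y, y ∈ A ∨ y ∈ B ∨ y = x := by
      intro y
      by_cases hy : y ∈ A ∪ B
      · exact (mem_union.1 hy).imp_right Or.inl
      · have : y ∈ (A ∪ B)ᶜ := mem_compl.2 hy
        rw [hx, mem_singleton] at this
        exact Or.inr (Or.inr this)
    have hxm : x ∈ (A ∪ B)ᶜ := by rw [hx, mem_singleton]
    rw [mem_compl, mem_union, not_or] at hxm
    -- a vertex of one side adjacent to `x` excludes the neighbours of `x` on the other side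
    have hside : ∀ P Q : Finset V, Q.card = 4 → (∀ y, y ∈ P ∨ y ∈ Q ∨ y = x) →
        (∀ a ∈ P, ∀ y ∈ P, ¬ Γ.Adj a y) → ∀ a ∈ P, Γ.Adj x a →
        (Γ.neighborFinset x ∩ Q).card ≤ 1 := by
      intro P Q hQ hcov hPP a ha hxa
      have hsub : Γ.neighborFinset a ⊆ insert x (Q \ Γ.neighborFinset x) := by
        intro y hy
        rw [SimpleGraph.mem_neighborFinset] at hy
        rw [mem_insert, mem_sdiff, SimpleGraph.mem_neighborFinset]
        rcases hcov y with h | h | h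
        · exact absurd hy (hPP a ha y h)
        · exact Or.inr ⟨h, fun hxy => hfree x a y hxa hy hxy.symm⟩
        · exact Or.inl h
      have h1 := card_le_card hsub
      have h2 := card_insert_le x (Q \ Γ.neighborFinset x)
      have h3 := card_sdiff_add_card_inter Q (Γ.neighborFinset x)
      rw [inter_comm] at h3
      rw [hN] at h1
      omega
    have hcov' : ∀ y, y ∈ B ∨ y ∈ A ∨ y = x := fun y => by have := hall y; tauto
    -- Otherwise `Q` is the neighbourhood of `x` and of every vertex of `P`, and a vertex of `Q` has
    -- the five neighbours `P ∪ {x}`. Once `x` has neighbours on both sides, `hside` leaves it at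
    -- most one on each, fewer than four in all.
    have hone : ∀ P Q : Finset V, P.card = 4 → Q.card = 4 → x ∉ P →
        (∀ y, y ∈ P ∨ y ∈ Q ∨ y = x) → (∀ a ∈ P, ∀ y ∈ P, ¬ Γ.Adj a y) →
        ∃ a ∈ P, Γ.Adj x a := by
      intro P Q hP hQ hxP hcov hPP
      by_contra! hno
      have hNP : ∀ y, y ≠ x → y ∉ Q → y ∈ P := fun y h1 h2 => by
        have := hcov y; tauto
      have hxsub : Γ.neighborFinset x ⊆ Q := by
        intro y hy
        rw [SimpleGraph.mem_neighborFinset] at hy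
        by_contra hyQ
        exact hno y (hNP y hy.ne.symm hyQ) hy
      have hxeq := eq_of_subset_of_card_le hxsub (by rw [hN, hQ])
      have hPfull : ∀ a ∈ P, Γ.neighborFinset a = Q := by
        intro a ha
        refine eq_of_subset_of_card_le ?_ (by rw [hN, hQ])
        intro y hy
        rw [SimpleGraph.mem_neighborFinset] at hy
        by_contra hyQ
        by_cases hyx : y = x
        · exact hno a ha (hyx ▸ hy.symm)
        · exact hPP a ha y (hNP y hyx hyQ) hy
      obtain ⟨b, hb⟩ := card_pos.1 (by omega : 0 < Q.card)
      have hsub : insert x P ⊆ Γ.neighborFinset b := by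
        intro y hy
        rw [SimpleGraph.mem_neighborFinset]
        rcases mem_insert.1 hy with rfl | hy
        · rw [← hxeq, SimpleGraph.mem_neighborFinset] at hb
          exact hb.symm
        · have := hPfull y hy ▸ hb
          rw [SimpleGraph.mem_neighborFinset] at this
          exact this.symm
      have := card_le_card hsub
      rw [card_insert_of_notMem hxP, hN, hP] at this
      omega
    obtain ⟨a, ha, hxa⟩ := hone A B (hN v) (hN w) hxm.1 hall hAA
    obtain ⟨b, hb, hxb⟩ := hone B A (hN w) (hN v) hxm.2 hcov' hBB
    have h1 := hside A B (hN w) hall hAA a ha hxa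
    have h2 := hside B A (hN v) hcov' hBB b hb hxb
    have hsub : Γ.neighborFinset x ⊆ Γ.neighborFinset x ∩ A ∪ Γ.neighborFinset x ∩ B := by
      intro y hy
      rw [← inter_union_distrib_left, mem_inter, mem_union]
      refine ⟨hy, ?_⟩
      rw [SimpleGraph.mem_neighborFinset] at hy
      have := hall y
      have := hy.ne.symm
      tauto
    have h3 := card_le_card hsub
    have h4 := card_union_le (Γ.neighborFinset x ∩ A) (Γ.neighborFinset x ∩ B)
    rw [hN] at h3
    omega
  have hall : ∀ y, y ∈ A ∨ y ∈ B := by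
    intro y
    have h0 : (A ∪ B)ᶜ = ∅ := card_eq_zero.1 (by omega)
    rw [compl_eq_empty_iff] at h0
    exact mem_union.1 (h0 ▸ mem_univ y)
  have hmem : ∀ y, y ∈ B ↔ y ∉ A := fun y =>
    ⟨fun h h' => disjoint_left.1 hdisj h' h, fun h => (hall y).resolve_left h⟩
  have hAadj : ∀ a ∈ A, ∀ y, Γ.Adj a y ↔ y ∈ B := by
    intro a ha y
    have hsub : Γ.neighborFinset a ⊆ B := by
      intro y hy
      rw [SimpleGraph.mem_neighborFinset] at hy
      exact (hmem y).2 fun hyA => hAA a ha y hyA hy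
    rw [← eq_of_subset_of_card_le hsub (by rw [hN, hN]), SimpleGraph.mem_neighborFinset]
  refine ⟨by omega, A, hN v, fun x y => ?_⟩
  by_cases hx : x ∈ A
  · rw [hAadj x hx, hmem]
    tauto
  · by_cases hy : y ∈ A
    · rw [Γ.adj_comm, hAadj y hy, hmem]
      tauto
    · have := hBB x ((hmem x).2 hx) y ((hmem y).2 hy)
      tauto

end Isotropic

/-! ### Even labellings from loops, digons, cycles and `K₄,₄`. -/

namespace Isotropic

open Finset

section

variable {V E : Type*} {F : Graph V E}

theorem IsFourRegular.finite_incidenceSet (hF : IsFourRegular F) (v : V) :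
    (F.incidenceSet v).Finite := by
  by_cases hv : v ∈ F.vertexSet
  · by_contra hinf
    have := hF v hv
    rw [Set.encard_eq_top hinf, top_add] at this
    exact absurd this (by decide)
  · refine Set.Finite.subset Set.finite_empty fun e he => hv ?_
    exact Graph.Inc.vertex_mem he

theorem IsEvenLabelling.add (hF : IsFourRegular F) {h k : E → ZMod 2}
    (hh : IsEvenLabelling F h) (hk : IsEvenLabelling F k) : IsEvenLabelling F (h + k) := by
  intro v
  have hfin : {e | F.IsNonloopAt e v}.Finite :=
    (hF.finite_incidenceSet v).subset fun e he => Graph.IsNonloopAt.inc he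
  have := finsum_mem_add_distrib (f := h) (g := k) hfin
  rw [hh v, hk v, add_zero] at this
  exact this

theorem IsFourRegular.exists_inc_ne_of_isLoopAt (hF : IsFourRegular F) {v : V} {e : E}
    (he : F.IsLoopAt e v) : ∃ f, F.Inc f v ∧ f ≠ e := by
  by_contra! hno
  have h1 : F.incidenceSet v = {e} := Set.eq_singleton_iff_unique_mem.2 ⟨he.inc, hno⟩
  have h2 : F.loopSet v = {e} := Set.eq_singleton_iff_unique_mem.2
    ⟨he, fun f hf => hno f (Graph.IsLoopAt.inc hf)⟩
  have := hF v he.vertex_mem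
  rw [h1, h2, Set.encard_singleton] at this
  exact absurd this (by decide)

theorem IsFourRegular.exists_inc_ne_of_isLink (hF : IsFourRegular F)
    (hloop : ∀ e v, ¬ F.IsLoopAt e v) {v w : V} {e f : E} (hef : e ≠ f) (he : F.IsLink e v w) :
    ∃ k, F.Inc k v ∧ k ≠ e ∧ k ≠ f := by
  by_contra! hno
  have h1 : F.incidenceSet v ⊆ {e, f} := fun k hk => by
    by_cases h : k = e
    · exact Or.inl h
    · exact Or.inr (hno k hk h)
  have h2 : F.loopSet v = ∅ := Set.eq_empty_of_forall_notMem fun k hk => hloop k v hk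
  have h3 := Set.encard_le_encard h1
  rw [Set.encard_pair hef] at h3
  have := hF v he.left_mem
  rw [h2, Set.encard_empty, add_zero] at this
  rw [this] at h3
  exact absurd h3 (by decide)

/-- The indicator of the loop works: evenness ignores loops, and the loop accounts for only 2 of the
degree 4, so another edge at `v` has label 0. -/
theorem exists_labelling_of_isLoopAt (hF : IsFourRegular F) {e : E} {v : V}
    (he : F.IsLoopAt e v) :
    ∃ h, IsEvenLabelling F h ∧ (∀ w ∉ ({v} : Finset V), IsConstantAt F h w) ∧
      ¬ IsConstantAt F h v := by
  classical
  obtain ⟨f, hf, hfe⟩ := hF.exists_inc_ne_of_isLoopAt he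
  refine ⟨Pi.single e 1, fun w => ?_, fun w hw => ?_, fun hc => ?_⟩
  · refine finsum_mem_eq_zero_of_forall_eq_zero fun g hg => ?_
    have hg' : F.IsNonloopAt g w := hg
    refine Pi.single_eq_of_ne ?_ _
    rintro rfl
    exact he.not_isNonloopAt w hg'
  · have hz : ∀ g, F.Inc g w → (Pi.single e 1 : E → ZMod 2) g = 0 := by
      intro g hg
      refine Pi.single_eq_of_ne ?_ _
      rintro rfl
      exact hw (mem_singleton.2 (he.eq_of_inc hg).symm)
    intro a b ha hb
    rw [hz a ha, hz b hb]
  · have := hc e f he.inc hf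
    rw [Pi.single_eq_same, Pi.single_eq_of_ne hfe] at this
    exact one_ne_zero this

/-- The indicator of the digon works; a third edge at `v` shows that it is not constant there. -/
theorem exists_labelling_of_parallel (hF : IsFourRegular F) (hloop : ∀ e v, ¬ F.IsLoopAt e v)
    [DecidableEq V] {e f : E} {v w : V} (he : F.IsLink e v w) (hf : F.IsLink f v w)
    (hef : e ≠ f) :
    ∃ h, IsEvenLabelling F h ∧ (∀ x ∉ ({v, w} : Finset V), IsConstantAt F h x) ∧
      ¬ IsConstantAt F h v := by
  classical
  have hvw : v ≠ w := by
    rintro rfl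
    exact hloop e v he
  obtain ⟨k, hk, hke, hkf⟩ := hF.exists_inc_ne_of_isLink hloop hef he
  have hlink : ∀ g x, (Pi.single e 1 + Pi.single f 1 : E → ZMod 2) g ≠ 0 → F.Inc g x →
      x = v ∨ x = w := by
    intro g x hg hx
    by_cases h1 : g = e
    · subst h1; exact hx.eq_or_eq_of_isLink he
    by_cases h2 : g = f
    · subst h2; exact hx.eq_or_eq_of_isLink hf
    · exact absurd (by rw [Pi.add_apply, Pi.single_eq_of_ne h1, Pi.single_eq_of_ne h2, add_zero]) hg
  have hz : ∀ x ∉ ({v, w} : Finset V), ∀ g, F.Inc g x →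
      (Pi.single e 1 + Pi.single f 1 : E → ZMod 2) g = 0 := by
    intro x hx g hg
    by_contra hne
    exact hx (by rw [mem_insert, mem_singleton]; exact hlink g x hne hg)
  refine ⟨Pi.single e 1 + Pi.single f 1, fun x => ?_, fun x hx a b ha hb => ?_, fun hc => ?_⟩
  · by_cases hx : x ∈ ({v, w} : Finset V)
    · have hnl : ∀ g, F.IsLink g v w → F.IsNonloopAt g x := by
        intro g hg
        rw [mem_insert, mem_singleton] at hx
        rcases hx with rfl | rfl
        exacts [⟨w, hvw.symm, hg⟩, ⟨v, hvw, hg.symm⟩]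
      have hsub : (↑({e, f} : Finset E) : Set E) ⊆ {g | F.IsNonloopAt g x} := by
        intro g hg
        rw [mem_coe, mem_insert, mem_singleton] at hg
        rcases hg with rfl | rfl
        exacts [hnl _ he, hnl _ hf]
      have : ∑ᶠ g ∈ {g | F.IsNonloopAt g x}, (Pi.single e 1 + Pi.single f 1 : E → ZMod 2) g =
          ∑ g ∈ ({e, f} : Finset E), (Pi.single e 1 + Pi.single f 1 : E → ZMod 2) g := by
        refine finsum_mem_eq_sum_of_inter_support_eq _ ?_
        ext g
        constructor
        · rintro ⟨-, hg⟩
          refine ⟨?_, hg⟩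
          by_contra hno
          rw [mem_coe, mem_insert, mem_singleton, not_or] at hno
          exact hg (by rw [Pi.add_apply, Pi.single_eq_of_ne hno.1, Pi.single_eq_of_ne hno.2,
            add_zero])
        · rintro ⟨h1, h2⟩
          exact ⟨hsub h1, h2⟩
      rw [this, sum_pair hef]
      simp [hef, hef.symm, CharTwo.add_self_eq_zero]
    · exact finsum_mem_eq_zero_of_forall_eq_zero fun g hg =>
        hz x hx g (Graph.IsNonloopAt.inc hg)
  · rw [hz x hx a ha, hz x hx b hb]
  · have := hc e k he.inc_left hk
    simp [hef, hke, hkf] at this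

/-- The simple graph obtained by forgetting loops and multiplicities. -/
def simplification (F : Graph V E) : SimpleGraph V where
  Adj v w := v ≠ w ∧ F.Adj v w
  symm := ⟨fun _ _ h => ⟨h.1.symm, h.2.symm⟩⟩
  loopless := ⟨fun _ h => h.1 rfl⟩

open Classical in
/-- The labelling that is `1` exactly on the edges of the subgraph `H`. -/
noncomputable def edgeLabelling (F : Graph V E) (H : SimpleGraph V) (e : E) : ZMod 2 :=
  if ∃ x y, F.IsLink e x y ∧ H.Adj x y then 1 else 0

theorem edgeLabelling_of_isLink {H : SimpleGraph V} {e : E} {v w : V} [Decidable (H.Adj v w)]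
    (he : F.IsLink e v w) : edgeLabelling F H e = if H.Adj v w then 1 else 0 := by
  classical
  refine if_congr ⟨?_, fun h => ⟨v, w, he, h⟩⟩ rfl rfl
  rintro ⟨x, y, hxy, h⟩
  rcases he.eq_and_eq_or_eq_and_eq hxy with ⟨rfl, rfl⟩ | ⟨rfl, rfl⟩
  exacts [h, h.symm]

theorem isConstantAt_edgeLabelling {H : SimpleGraph V} {v : V}
    (hv : (∀ w, ¬ H.Adj v w) ∨ ∀ w, F.Adj v w → H.Adj v w) :
    IsConstantAt F (edgeLabelling F H) v := by
  classical
  rintro e f ⟨x, he⟩ ⟨y, hf⟩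
  rw [edgeLabelling_of_isLink he, edgeLabelling_of_isLink hf]
  rcases hv with hv | hv
  · rw [if_neg (hv x), if_neg (hv y)]
  · rw [if_pos (hv x he.adj), if_pos (hv y hf.adj)]

theorem not_isConstantAt_edgeLabelling {H : SimpleGraph V} {v x y : V} (hx : F.Adj v x)
    (hy : F.Adj v y) (hHx : H.Adj v x) (hHy : ¬ H.Adj v y) :
    ¬ IsConstantAt F (edgeLabelling F H) v := by
  classical
  obtain ⟨e, he⟩ := hx
  obtain ⟨f, hf⟩ := hy
  intro hc
  have := hc e f he.inc_left hf.inc_left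
  rw [edgeLabelling_of_isLink he, edgeLabelling_of_isLink hf, if_pos hHx, if_neg hHy] at this
  exact one_ne_zero this

theorem exists_edge_of_neighbor [Nonempty E] (hloop : ∀ e v, ¬ F.IsLoopAt e v)
    (hpar : ∀ e f v w, F.IsLink e v w → F.IsLink f v w → e = f) (v : V) :
    ∃ ε : V → E, (∀ w, (simplification F).Adj v w → F.IsLink (ε w) v w) ∧
      Set.InjOn ε ((simplification F).neighborSet v) ∧
      F.incidenceSet v = ε '' (simplification F).neighborSet v := by
  have hex : ∀ w, ∃ e, (simplification F).Adj v w → F.IsLink e v w := by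
    intro w
    by_cases h : (simplification F).Adj v w
    · obtain ⟨e, he⟩ := h.2
      exact ⟨e, fun _ => he⟩
    · exact ⟨Classical.arbitrary E, fun h' => absurd h' h⟩
  choose ε hε using hex
  refine ⟨ε, hε, fun a ha b hb hab => ?_, ?_⟩
  · have h1 := hε a ha
    rw [hab] at h1
    exact h1.right_unique (hε b hb)
  · ext e
    constructor
    · rintro ⟨w, hw⟩
      have hadj : (simplification F).Adj v w :=
        ⟨fun h => hloop e v (by rw [← h] at hw; exact hw), hw.adj⟩
      exact ⟨w, hadj, hpar _ _ _ _ (hε w hadj) hw⟩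
    · rintro ⟨w, hw, rfl⟩
      exact (hε w hw).inc_left

theorem isRegularOfDegree_simplification [Fintype V] [Nonempty E]
    [DecidableRel (simplification F).Adj] (hV : F.vertexSet = Set.univ) (hF : IsFourRegular F)
    (hloop : ∀ e v, ¬ F.IsLoopAt e v)
    (hpar : ∀ e f v w, F.IsLink e v w → F.IsLink f v w → e = f) :
    (simplification F).IsRegularOfDegree 4 := by
  intro v
  obtain ⟨ε, -, hinj, hinc⟩ := exists_edge_of_neighbor hloop hpar v
  have h2 : F.loopSet v = ∅ := Set.eq_empty_of_forall_notMem fun k hk => hloop k v hk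
  have h4 := hF v (hV ▸ Set.mem_univ v)
  rw [h2, hinc, hinj.encard_image, Set.encard_empty, add_zero, Set.encard_eq_coe_toFinset_card] at h4
  rw [← SimpleGraph.card_neighborFinset_eq_degree]
  exact_mod_cast h4

/-- Without loops and parallel edges, edges at `v` correspond to neighbours of `v`, so the labels at
`v` sum to the degree of `v` in `H`. -/
theorem isEvenLabelling_edgeLabelling [Fintype V] [Nonempty E]
    (hloop : ∀ e v, ¬ F.IsLoopAt e v)
    (hpar : ∀ e f v w, F.IsLink e v w → F.IsLink f v w → e = f)
    {H : SimpleGraph V} [DecidableRel H.Adj] (hH : H ≤ simplification F)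
    (heven : ∀ v, Even (H.degree v)) : IsEvenLabelling F (edgeLabelling F H) := by
  classical
  intro v
  obtain ⟨ε, hε, hinj, hinc⟩ := exists_edge_of_neighbor hloop hpar v
  have hset : {e | F.IsNonloopAt e v} = ε '' (simplification F).neighborSet v := by
    rw [← hinc]
    ext e
    exact ⟨fun h => Graph.IsNonloopAt.inc h,
      fun h => (Graph.Inc.isLoopAt_or_isNonloopAt h).resolve_left (hloop e v)⟩
  rw [hset, finsum_mem_image hinj, ← SimpleGraph.coe_neighborFinset, finsum_mem_coe_finset]
  have hval : ∀ w ∈ (simplification F).neighborFinset v,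
      edgeLabelling F H (ε w) = if H.Adj v w then 1 else 0 := fun w hw =>
    edgeLabelling_of_isLink (hε w ((SimpleGraph.mem_neighborFinset _ _ _).1 hw))
  rw [sum_congr rfl hval, sum_boole]
  have hfil : {w ∈ (simplification F).neighborFinset v | H.Adj v w} = H.neighborFinset v := by
    ext w
    rw [mem_filter, SimpleGraph.mem_neighborFinset, SimpleGraph.mem_neighborFinset]
    exact ⟨fun h => h.2, fun h => ⟨hH h, h⟩⟩
  rw [hfil, SimpleGraph.card_neighborFinset_eq_degree, ZMod.natCast_eq_zero_iff_even]
  exact heven v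

/-- The indicator of the cycle takes the value 1 on exactly two of the four edges at `c 0`. -/
theorem exists_labelling_of_isPeriodicCycle [Fintype V] [DecidableEq V] [Nonempty E]
    (hV : F.vertexSet = Set.univ)
    (hF : IsFourRegular F) (hloop : ∀ e v, ¬ F.IsLoopAt e v)
    (hpar : ∀ e f v w, F.IsLink e v w → F.IsLink f v w → e = f) {g : ℕ} {c : ℕ → V}
    (hc : IsPeriodicCycle (simplification F) g c) :
    ∃ h, IsEvenLabelling F h ∧ (∀ v ∉ (range g).image c, IsConstantAt F h v) ∧
      ¬ IsConstantAt F h (c 0) := by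
  classical
  refine ⟨edgeLabelling F hc.toSimpleGraph,
    isEvenLabelling_edgeLabelling hloop hpar hc.toSimpleGraph_le hc.even_degree,
    fun v hv => isConstantAt_edgeLabelling (Or.inl ?_), ?_⟩
  · have hmem : ∀ i, c i ∈ (range g).image c := fun i => mem_image.2
      ⟨i % g, mem_range.2 (Nat.mod_lt _ (by have := hc.three_le; omega)), hc.mod i⟩
    rintro w ⟨i, ⟨rfl, -⟩ | ⟨-, rfl⟩⟩
    exacts [hv (hmem _), hv (hmem _)]
  · have hdeg := isRegularOfDegree_simplification hV hF hloop hpar (c 0)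
    rw [← SimpleGraph.card_neighborFinset_eq_degree] at hdeg
    have hlt : ({c (0 + 1), c (0 + (g - 1))} : Finset V).card <
        ((simplification F).neighborFinset (c 0)).card :=
      lt_of_le_of_lt card_le_two (by omega)
    obtain ⟨y, hy, hyn⟩ := exists_mem_notMem_of_card_lt_card hlt
    rw [SimpleGraph.mem_neighborFinset] at hy
    refine not_isConstantAt_edgeLabelling (hc.adj 0).2 hy.2
      ((hc.toSimpleGraph_adj_iff 0 _).2 (Or.inl rfl)) ?_
    rw [hc.toSimpleGraph_adj_iff]
    simpa using hyn

/-- The edges of `Γ` having an end in `S`. -/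
def starGraph (Γ : SimpleGraph V) (S : Finset V) : SimpleGraph V where
  Adj x y := Γ.Adj x y ∧ (x ∈ S ∨ y ∈ S)
  symm := ⟨fun _ _ h => ⟨h.1.symm, h.2.symm⟩⟩
  loopless := ⟨fun x h => Γ.loopless.irrefl x h.1⟩

/-- One 4-cycle would only give `κ ≤ 7`, so two labellings on the same four vertices are needed. For
a pair of vertices outside `A`, label 1 the edges meeting the pair: each vertex of `A` sees two of
them, and a vertex outside `A` sees all four of its edges or none. The pairs `{b₁, b₂}` and `{b₁,
b₃}` are used. -/
theorem exists_labellings_of_completeBipartite [Fintype V] [Nonempty E]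
    (hloop : ∀ e v, ¬ F.IsLoopAt e v)
    (hpar : ∀ e f v w, F.IsLink e v w → F.IsLink f v w → e = f) {A : Finset V}
    (hA : A.card = 4) (hV : Fintype.card V = 8)
    (hadj : ∀ x y, (simplification F).Adj x y ↔ (x ∈ A ↔ y ∉ A)) :
    ∃ h k, IsEvenLabelling F h ∧ IsEvenLabelling F k ∧ (∀ v ∉ A, IsConstantAt F h v) ∧
      (∀ v ∉ A, IsConstantAt F k v) ∧ (∃ v, ¬ IsConstantAt F h v) ∧ (∃ v, ¬ IsConstantAt F k v) ∧
      ∃ v, ¬ IsConstantAt F (h + k) v := by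
  classical
  have hB : Aᶜ.card = 4 := by rw [card_compl]; omega
  obtain ⟨a, ha⟩ := card_pos.1 (by omega : 0 < A.card)
  obtain ⟨b₁, h₁, b₂, h₂, b₃, h₃, h12, h13, h23⟩ := two_lt_card.1 (by omega : 2 < Aᶜ.card)
  rw [mem_compl] at h₁ h₂ h₃
  have hnA : ∀ v ∈ A, ∀ b, b ∉ A → v ≠ b := fun v hv b hb h => hb (h ▸ hv)
  have hFadj : ∀ v ∈ A, ∀ b, b ∉ A → F.Adj v b := fun v hv b hb =>
    ((hadj v b).2 (by tauto)).2
  have hfacts : ∀ x, x ∉ A → ∀ y, y ∉ A → ∀ z, z ∉ A → x ≠ y → x ≠ z → y ≠ z →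
      IsEvenLabelling F (edgeLabelling F (starGraph (simplification F) {x, y})) ∧
      (∀ v ∉ A, IsConstantAt F (edgeLabelling F (starGraph (simplification F) {x, y})) v) ∧
      ¬ IsConstantAt F (edgeLabelling F (starGraph (simplification F) {x, y})) a := by
    intro x hx y hy z hz hxy hxz hyz
    have hstarA : ∀ v ∈ A, ∀ w, (starGraph (simplification F) {x, y}).Adj v w ↔
        w = x ∨ w = y := by
      intro v hv w
      have hvx := hnA v hv x hx
      have hvy := hnA v hv y hy
      simp only [starGraph, hadj, mem_insert, mem_singleton, hvx, hvy, false_or, hv, true_iff]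
      refine and_iff_right_of_imp ?_
      rintro (rfl | rfl) <;> assumption
    have hstarB : ∀ v ∉ A, ∀ w, (starGraph (simplification F) {x, y}).Adj v w ↔
        w ∈ A ∧ (v = x ∨ v = y) := by
      intro v hv w
      simp only [starGraph, hadj, mem_insert, mem_singleton, hv, false_iff, not_not]
      refine and_congr_right fun hw => or_iff_left ?_
      rintro (rfl | rfl) <;> contradiction
    refine ⟨isEvenLabelling_edgeLabelling hloop hpar (fun _ _ h => h.1) fun v => ?_,
      fun v hv => isConstantAt_edgeLabelling ?_, ?_⟩
    · rw [← SimpleGraph.card_neighborFinset_eq_degree]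
      by_cases hv : v ∈ A
      · have : (starGraph (simplification F) {x, y}).neighborFinset v = {x, y} := by
          ext w
          rw [SimpleGraph.mem_neighborFinset, hstarA v hv, mem_insert, mem_singleton]
        rw [this, card_pair hxy]
        exact even_two
      · by_cases hvS : v = x ∨ v = y
        · have : (starGraph (simplification F) {x, y}).neighborFinset v = A := by
            ext w
            rw [SimpleGraph.mem_neighborFinset, hstarB v hv, and_iff_left hvS]
          rw [this, hA]
          decide
        · have : (starGraph (simplification F) {x, y}).neighborFinset v = ∅ := by
            ext w
            simp [hstarB v hv, hvS]
          rw [this]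
          simp
    · by_cases hvS : v = x ∨ v = y
      · refine Or.inr fun w hw => (hstarB v hv w).2 ⟨?_, hvS⟩
        by_contra hwA
        by_cases hvw : v = w
        · obtain ⟨e, he⟩ := hw
          rw [← hvw] at he
          exact hloop e v he
        · have := (hadj v w).1 ⟨hvw, hw⟩
          tauto
      · exact Or.inl fun w h => hvS ((hstarB v hv w).1 h).2
    · refine not_isConstantAt_edgeLabelling (hFadj a ha x hx) (hFadj a ha z hz)
        ((hstarA a ha x).2 (Or.inl rfl)) fun h => ?_
      rcases (hstarA a ha z).1 h with h | h
      exacts [hxz h.symm, hyz h.symm]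
  obtain ⟨p1, p2, p3⟩ := hfacts b₁ h₁ b₂ h₂ b₃ h₃ h12 h13 h23
  obtain ⟨q1, q2, q3⟩ := hfacts b₁ h₁ b₃ h₃ b₂ h₂ h13 h12 h23.symm
  -- In the sum, the edge from `a` to `b₁` gets `1 + 1 = 0` and the edge to `b₂` gets `1 + 0 = 1`.
  refine ⟨_, _, p1, q1, p2, q2, ⟨a, p3⟩, ⟨a, q3⟩, a, fun hc => ?_⟩
  obtain ⟨e₁, he₁⟩ := hFadj a ha b₁ h₁
  obtain ⟨e₂, he₂⟩ := hFadj a ha b₂ h₂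
  have := hc e₁ e₂ he₁.inc_left he₂.inc_left
  rw [Pi.add_apply, Pi.add_apply, edgeLabelling_of_isLink he₁, edgeLabelling_of_isLink he₁,
    edgeLabelling_of_isLink he₂, edgeLabelling_of_isLink he₂] at this
  simp [starGraph, hadj, ha, h₁, h₂, h12.symm, h23, hnA a ha b₁ h₁, hnA a ha b₂ h₂, hnA a ha b₃ h₃,
    CharTwo.add_self_eq_zero] at this

end

/-! ### Bounds on the vertical connectivity from labellings. -/

section

variable {V E : Type*} [Fintype V] {F : Graph V E} {C : V → List (V × E)}

/-- The diagonal entry at `v` is multiplied by `u v = 0`, which is why loops of `G` play no role. -/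
theorem mulVec_adjMatrix_of_eq_zero (G : LoopedGraph V) [DecidableRel G.toSimpleGraph.Adj]
    {u : V → ZMod 2} {v : V} (hv : u v = 0) :
    G.adjMatrix.mulVec u v = ∑ w, if G.toSimpleGraph.Adj v w then u w else 0 := by
  refine sum_congr rfl fun w _ => ?_
  by_cases hvw : v = w
  · subst hvw
    simp [hv]
  · by_cases h : G.toSimpleGraph.Adj v w <;> simp [LoopedGraph.adjMatrix, hvw, h]

/-- Labellings that are constant outside a small set of vertices bound the vertical
connectivity. -/
theorem verticalConnectivity_add_le_of_labellings {G : LoopedGraph V}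
    (hV : F.vertexSet = Set.univ) (hF : IsFourRegular F) (hC : IsEulerSystem F C)
    (hG : G.toSimpleGraph = interlacementGraph C) (A : Finset V) :
    (∀ h, IsEvenLabelling F h → (∀ v ∉ A, IsConstantAt F h v) → (∃ v, ¬ IsConstantAt F h v) →
      2 * A.card ≤ Fintype.card V →
        verticalConnectivity G.isotropicMatroid + 1 ≤ 2 * A.card) ∧
    (∀ h k, IsEvenLabelling F h → IsEvenLabelling F k → (∀ v ∉ A, IsConstantAt F h v) →
      (∀ v ∉ A, IsConstantAt F k v) → (∃ v, ¬ IsConstantAt F h v) →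
      (∃ v, ¬ IsConstantAt F k v) → (∃ v, ¬ IsConstantAt F (h + k) v) →
      2 * A.card ≤ Fintype.card V + 1 →
        verticalConnectivity G.isotropicMatroid + 3 ≤ 2 * A.card) := by
  classical
  obtain ⟨Φ, hΦ⟩ := hC.exists_linearMap hV hF
  have hne : ∀ h, IsEvenLabelling F h → (∃ v, ¬ IsConstantAt F h v) → Φ h ≠ 0 :=
    fun h hh ⟨v, hv⟩ h0 => hv ((hΦ h hh).2 h0 v)
  have hzero : ∀ h, IsEvenLabelling F h → (∀ v ∉ A, IsConstantAt F h v) → ∀ v ∉ A,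
      Φ h v = 0 ∧ G.adjMatrix.mulVec (Φ h) v = 0 := by
    intro h hh hA v hv
    obtain ⟨h1, h2⟩ := (hΦ h hh).1 v (hA v hv)
    refine ⟨h1, ?_⟩
    rw [mulVec_adjMatrix_of_eq_zero G h1]
    simp only [hG]
    exact h2
  constructor
  · intro h hh hA hn hcard
    have hu : LinearIndependent (ZMod 2) ![Φ h] := by
      rw [linearIndependent_unique_iff]
      exact hne h hh hn
    have hz := hzero h hh hA
    have := G.verticalConnectivity_add_le (A := A) hu
      (by intro i v hv; fin_cases i; exact (hz v hv).1)
      (by intro i v hv; fin_cases i; exact (hz v hv).2) one_pos (by omega)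
    omega
  · intro h k hh hk hA kA hn kn hkn hcard
    have hu : LinearIndependent (ZMod 2) ![Φ h, Φ k] := by
      rw [LinearIndependent.pair_iff]
      have h2 : ∀ s : ZMod 2, s = 0 ∨ s = 1 := by decide
      intro s t hst
      rcases h2 s with rfl | rfl <;> rcases h2 t with rfl | rfl
      · exact ⟨rfl, rfl⟩
      · exact absurd (by simpa using hst) (hne k hk kn)
      · exact absurd (by simpa using hst) (hne h hh hn)
      · exact absurd (by simpa [map_add] using hst) (hne _ (hh.add hF hk) hkn)
    have hz := hzero h hh hA
    have kz := hzero k hk kA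
    have := G.verticalConnectivity_add_le (A := A) hu
      (by intro i v hv; fin_cases i; exacts [(hz v hv).1, (kz v hv).1])
      (by intro i v hv; fin_cases i; exacts [(hz v hv).2, (kz v hv).2]) two_pos (by omega)
    omega

end

end Isotropic

theorem mainTheorem8 {V : Type*} [Finite V] (G : Isotropic.LoopedGraph V)
    (hG : G.IsCircleGraph) :
    Isotropic.verticalConnectivity G.isotropicMatroid ≤ max 5 (Nat.card V - 3) := by
  classical
  obtain ⟨E, F, C, hV, hF, hC, hGC⟩ := hG
  have := Fintype.ofFinite V
  rw [Nat.card_eq_fintype_card]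
  -- Here the rank bound `κ ≤ n` suffices. From `n ≥ 6` on, sets of at most three vertices satisfy
  -- the size condition `2|A| ≤ n` in `key`.
  by_cases h5 : Fintype.card V ≤ 5
  · exact (G.verticalConnectivity_le_card.trans h5).trans (le_max_left _ _)
  have hne : Nonempty V := Fintype.card_pos_iff.1 (by omega)
  have key := Isotropic.verticalConnectivity_add_le_of_labellings hV hF hC hGC
  rw [le_max_iff]
  by_cases hloop : ∃ e v, F.IsLoopAt e v
  · obtain ⟨e, v, he⟩ := hloop
    obtain ⟨h, h1, h2, h3⟩ := Isotropic.exists_labelling_of_isLoopAt hF he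
    have := (key _).1 h h1 h2 ⟨v, h3⟩ (by rw [Finset.card_singleton]; omega)
    rw [Finset.card_singleton] at this
    omega
  push Not at hloop
  by_cases hpar : ∃ e f v w, F.IsLink e v w ∧ F.IsLink f v w ∧ e ≠ f
  · obtain ⟨e, f, v, w, he, hf, hef⟩ := hpar
    obtain ⟨h, h1, h2, h3⟩ := Isotropic.exists_labelling_of_parallel hF hloop he hf hef
    have hc : ({v, w} : Finset V).card ≤ 2 := Finset.card_le_two
    have := (key _).1 h h1 h2 ⟨v, h3⟩ (by omega)
    omega
  push Not at hpar
  have hE : Nonempty E := by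
    obtain ⟨v⟩ := hne
    by_contra hno
    rw [not_nonempty_iff] at hno
    have := hF v (hV ▸ Set.mem_univ v)
    simp [Set.eq_empty_of_isEmpty] at this
  rcases Isotropic.exists_short_cycle_or_completeBipartite
    (Isotropic.isRegularOfDegree_simplification hV hF hloop hpar) with
    ⟨g, c, hc, hg⟩ | ⟨h8, A, hA, hadj⟩
  · obtain ⟨h, h1, h2, h3⟩ :=
      Isotropic.exists_labelling_of_isPeriodicCycle hV hF hloop hpar hc
    have hcard : ((Finset.range g).image c).card ≤ g := by
      simpa using Finset.card_image_le (s := Finset.range g) (f := c)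
    have := (key _).1 h h1 h2 ⟨_, h3⟩ (by omega)
    omega
  · obtain ⟨h, k, h1, h2, h3, h4, h5, h6, h7⟩ :=
      Isotropic.exists_labellings_of_completeBipartite hloop hpar hA h8 hadj
    have := (key A).2 h k h1 h2 h3 h4 h5 h6 h7 (by omega)
    omega
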